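/- Let $n\ge 1$ and let $\Theta:[0,+\infty)\to(0,+\infty)$ be non-decreasing and locally Lipschitz, such that: (I) if $n>1$, there is $\alpha\in(1,\frac{n}{n-1})$ such that $\Theta^{\frac{\alpha-1}{\alpha}}$ is convex; if $n=1$, $\Theta$ is convex; (II) there is $C_\Theta\ge1$ such that $\Theta:[C_\Theta,+\infty)\to[\Theta(C_\Theta),+\infty)$ is bijective and $\Theta(s_1)\Theta(s_2)\le\Theta(C_\Theta s_1s_2)$ for all $s_1,s_2\ge C_\Theta$; (III) $\int_1^\infty\frac{\Theta'(s)}{s\,\Theta(s)}\,ds=+\infty$. Then there is a non-decreasing $\omega:[0,+\infty)\to[0,+\infty)$ (depending only on $n$ and $\Theta$) with $\omega(0)=0$, $\omega(\delta)>0$ for $\delta>0$ and $\int_0^1\frac{d\delta}{\omega(\delta)}=+\infty$, such that the following holds. Let $I\subset\mathbb R$ be an open interval, $\Omega\subset\mathbb R^n$ an open set and $b\in L^1_{\mathrm{loc}}(I;W^{1,1}_{\mathrm{loc}}(\Omega;\mathbb R^n))$, with weak spatial differential $D_xb$, and let $\|\cdot\|$ be the operator norm. For $o\in\Omega$, $c>0$,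 $R>0$ with $B(o,2R)\subset\Omega$ put $$\psi_{o,c,R}(t)=\int_{B(o,2R)}\Theta(c\,\|D_xb(t,z)\|)\,dz .$$ Assume that for every $o\in\Omega$ there are $c>0$ and $R>0$ with $B(o,2R)\subset\Omega$ and $\psi_{o,c,R}\in L^1_{\mathrm{loc}}(I)$. Then: 1. There is $\tilde b:I\times\Omega\to\mathbb R^n$ such that, for a.e. $t\in I$, $\tilde b(t,\cdot)$ is continuous on $\Omega$ and equal to $b(t,\cdot)$ a.e. in $\Omega$. Points 2–4 hold for every such $\tilde b$. 2. Whenever $c,R>0$, $B(o,2R)\subset\Omega$ and $\psi_{o,c,R}\in L^1_{\mathrm{loc}}(I)$, there is a positive $\varphi\in L^1_{\mathrm{loc}}(I)$ such that, for a.e. $t\in I$, $|\tilde b(t,x)-\tilde b(t,y)|\le\varphi(t)\,\omega(|x-y|)$ for all $x,y\in B(o,R)$. 3. $\tilde b$ is well-posed in $I\times\Omega$: for every $(s,x)\in I\times\Omega$ there is $\epsilon>0$ with $(s-\epsilon,s+\epsilon)\subset I$ such that there is exactly one absolutely continuous $\gamma:(s-\epsilon,s+\epsilon)\to\Omega$ with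 $\dot\gamma(t)=\tilde b(t,\gamma(t))$ for a.e. $t$ and $\gamma(s)=x$. 4. Assume moreover that for every $o\in\Omega$ there are $r>0$ and $m\in L^1(I)$ such that $|b(t,x)|\le m(t)$ for a.e. $t\in I$ and a.e. $x\in B(o,r)\cap\Omega$. Then for every $(s,x)\in\overline I\times\Omega$ there are $\epsilon>0$ and an absolutely continuous $\gamma:I\cap(s-\epsilon,s+\epsilon)\to\Omega$ with $\dot\gamma(t)=\tilde b(t,\gamma(t))$ for a.e. $t$ and $\gamma(s)=x$ (as a limit, if $s\in\partial I$). If, in addition, the condition on $\psi$ holds up to the endpoints of $I$, that is, for every $o\in\Omega$ the numbers $c,R>0$ with $B(o,2R)\subset\Omega$ can be chosen such that $\psi_{o,c,R}\in L^1_{\mathrm{loc}}(\overline I)$, then $\tilde b$ is well-posed in $\overline I\times\Omega$: for every $(s,x)\in\overline I\times\Omega$ there is $\epsilon>0$ for which such a $\gamma$ on $I\cap(s-\epsilon,s+\epsilon)$ exists and is unique. -/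

import Mathlib

open Set MeasureTheory Filter Topology

noncomputable section

/-- Euclidean space `ℝⁿ`; linear maps `Eucl n →L[ℝ] Eucl n` carry the operator norm. -/
abbrev Eucl (n : ℕ) : Type := EuclideanSpace ℝ (Fin n)

/-- The conditions on the function `Θ : [0,∞) → (0,∞)`, which is represented by a function on `ℝ`
of which only the values on `[0,∞)` matter. -/
structure IsAdmissibleTheta (n : ℕ) (Θ : ℝ → ℝ) : Prop where
  pos : ∀ s, 0 ≤ s → 0 < Θ s
  monotoneOn : MonotoneOn Θ (Ici 0)
  locallyLipschitzOn : LocallyLipschitzOn (Ici 0) Θ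
  /-- some power `Θ ^ ((α - 1) / α)` with `1 < α < n / (n - 1)` is convex, if `n > 1` -/
  convex_of_one_lt : 1 < n → ∃ α : ℝ, 1 < α ∧ α < (n : ℝ) / ((n : ℝ) - 1) ∧
    ConvexOn ℝ (Ici 0) (fun s => Θ s ^ ((α - 1) / α))
  convex_of_eq_one : n = 1 → ConvexOn ℝ (Ici 0) Θ
  quasi_submultiplicative : ∃ C : ℝ, 1 ≤ C ∧ BijOn Θ (Ici C) (Ici (Θ C)) ∧
    ∀ s₁ s₂, C ≤ s₁ → C ≤ s₂ → Θ s₁ * Θ s₂ ≤ Θ (C * s₁ * s₂)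
  /-- `∫₁^∞ Θ'(s) / (s Θ(s)) ds = ∞`; the integrand is nonnegative and defined almost everywhere -/
  integral_eq_top : ∫⁻ s in Ioi (1 : ℝ), ENNReal.ofReal (deriv Θ s / (s * Θ s)) = ⊤

/-- `D` is the weak (distributional) differential of `u` on the open set `Ω`, and both are locally
integrable on `Ω`; in other words `u ∈ W^{1,1}_loc(Ω; ℝⁿ)` with differential `D`. -/
structure HasWeakDifferential {n : ℕ} (Ω : Set (Eucl n)) (u : Eucl n → Eucl n)
    (D : Eucl n → Eucl n →L[ℝ] Eucl n) : Prop where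
  locallyIntegrableOn : LocallyIntegrableOn u Ω
  locallyIntegrableOn_diff : LocallyIntegrableOn D Ω
  integral_eq : ∀ η : Eucl n → ℝ, ContDiff ℝ ((⊤ : ℕ∞) : WithTop ℕ∞) η → HasCompactSupport η → tsupport η ⊆ Ω →
    ∀ v : Eucl n, ∫ x in Ω, (fderiv ℝ η x v) • u x = - ∫ x in Ω, η x • D x v

/-- `b ∈ L¹_loc(I; W^{1,1}_loc(Ω; ℝⁿ))` with weak spatial differential `D = D_x b`. -/
structure MemL1locW11loc {n : ℕ} (I : Set ℝ) (Ω : Set (Eucl n)) (b : ℝ → Eucl n → Eucl n)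
    (D : ℝ → Eucl n → Eucl n →L[ℝ] Eucl n) : Prop where
  locallyIntegrableOn : LocallyIntegrableOn (fun p : ℝ × Eucl n => b p.1 p.2) (I ×ˢ Ω)
  locallyIntegrableOn_diff : LocallyIntegrableOn (fun p : ℝ × Eucl n => D p.1 p.2) (I ×ˢ Ω)
  hasWeakDifferential : ∀ᵐ t ∂(volume.restrict I), HasWeakDifferential Ω (b t) (D t)

/-- The function `t ↦ ∫_{B(o,2R)} Θ(c ‖D(t,z)‖) dz` is integrable on every compact subset of `J`. -/
def OrliczIntegrable {n : ℕ} (Θ : ℝ → ℝ) (J : Set ℝ) (D : ℝ → Eucl n → Eucl n →L[ℝ] Eucl n)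
    (o : Eucl n) (c R : ℝ) : Prop :=
  ∀ K : Set ℝ, IsCompact K → K ⊆ J →
    ∫⁻ t in K, ∫⁻ z in Metric.ball o (2 * R), ENNReal.ofReal (Θ (c * ‖D t z‖)) < ⊤

/-- Every `o ∈ Ω` has a ball `B(o,2R) ⊆ Ω` on which the Orlicz condition holds for some `c > 0`,
locally integrably in time on `J`. -/
def LocallyOrliczIntegrable {n : ℕ} (Θ : ℝ → ℝ) (J : Set ℝ) (Ω : Set (Eucl n))
    (D : ℝ → Eucl n → Eucl n →L[ℝ] Eucl n) : Prop :=
  ∀ o ∈ Ω, ∃ c > 0, ∃ R > 0, Metric.ball o (2 * R) ⊆ Ω ∧ OrliczIntegrable Θ J D o c R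

/-- `b'` is, for almost every time in `I`, a representative of `b` that is continuous in space. -/
def IsContinuousRepresentative {n : ℕ} (I : Set ℝ) (Ω : Set (Eucl n))
    (b b' : ℝ → Eucl n → Eucl n) : Prop :=
  ∀ᵐ t ∂(volume.restrict I), ContinuousOn (b' t) Ω ∧ b' t =ᵐ[volume.restrict Ω] b t

/-- An Osgood modulus `ω : [0,∞) → [0,∞)`. -/
structure IsOsgoodModulus (ω : ℝ → ℝ) : Prop where
  monotoneOn : MonotoneOn ω (Ici 0)
  zero : ω 0 = 0
  pos : ∀ δ, 0 < δ → 0 < ω δ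
  integral_eq_top : ∫⁻ δ in Ioo (0 : ℝ) 1, ENNReal.ofReal (1 / ω δ) = ⊤

/-- `γ` is an absolutely continuous solution, with values in `Ω`, of `γ' = b(t, γ)`, `γ(s) = x`, on
`I ∩ (s - ε, s + ε)`, where `I` is an open interval and `s ∈ closure I`. Only the values of `γ` at
`s` and on that interval matter: a curve on a bounded interval is absolutely continuous if and only
if it is the restriction of an absolutely continuous curve on a larger compact interval. If `s` is
an endpoint of `I`, then `γ(s) = x` says that `x` is the limit of `γ` at `s`. -/
structure IsSolutionNear {n : ℕ} (I : Set ℝ) (Ω : Set (Eucl n)) (b : ℝ → Eucl n → Eucl n)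
    (s : ℝ) (x : Eucl n) (ε : ℝ) (γ : ℝ → Eucl n) : Prop where
  absolutelyContinuous : AbsolutelyContinuousOnInterval γ (s - ε) (s + ε)
  mem : ∀ t ∈ I ∩ Ioo (s - ε) (s + ε), γ t ∈ Ω
  hasDerivAt : ∀ᵐ t ∂(volume.restrict (I ∩ Ioo (s - ε) (s + ε))), HasDerivAt γ (b t (γ t)) t
  initial : γ s = x

/-- There is exactly one solution on `I ∩ (s - ε, s + ε)`. -/
def HasUniqueSolutionNear {n : ℕ} (I : Set ℝ) (Ω : Set (Eucl n)) (b : ℝ → Eucl n → Eucl n)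
    (s : ℝ) (x : Eucl n) (ε : ℝ) : Prop :=
  (∃ γ, IsSolutionNear I Ω b s x ε γ) ∧
    ∀ γ₁ γ₂, IsSolutionNear I Ω b s x ε γ₁ → IsSolutionNear I Ω b s x ε γ₂ →
      EqOn γ₁ γ₂ (I ∩ Ioo (s - ε) (s + ε))

/-- `b` is well-posed in `I × Ω`. -/
def WellPosed {n : ℕ} (I : Set ℝ) (Ω : Set (Eucl n)) (b : ℝ → Eucl n → Eucl n) : Prop :=
  ∀ s ∈ I, ∀ x ∈ Ω, ∃ ε > 0, Ioo (s - ε) (s + ε) ⊆ I ∧ HasUniqueSolutionNear I Ω b s x ε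

/-- `b` is well-posed in `closure I × Ω`. -/
def WellPosedClosure {n : ℕ} (I : Set ℝ) (Ω : Set (Eucl n)) (b : ℝ → Eucl n → Eucl n) : Prop :=
  ∀ s ∈ closure I, ∀ x ∈ Ω, ∃ ε > 0, HasUniqueSolutionNear I Ω b s x ε

end

/-!
Convexity of a power `Θ ^ q` with `n q < 1` gives a Morrey estimate in Orlicz form. For a `C¹` map
`u` and a ball of diameter `δ = |x - y|` having `x` and `y` as antipodal points, the distance of
`u x` to the mean of `u` over the ball is an integral of `‖Du‖` over the segments from `x`, hence
over the copies of the ball contracted towards `x` by the factors `s ∈ (0, 1]`. Jensen's inequality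
for `Θ` on each copy costs a factor `s ^ (-n)`, and Jensen's inequality for `Θ ^ q` over `s` leaves
the integrable weight `s ^ (-n q)`; the outcome is
`Θ (c |u x - u y| / (2 δ)) ≤ M δ ^ (-n) ∫ Θ (c ‖Du‖)` (`exists_morrey_const`; in dimension one,
where `q = 1`, Jensen's inequality on the segment suffices). Mollification does not increase the
Orlicz energy, so the estimate passes to weakly differentiable maps, on a set of full measure
(`exists_morrey_const_of_hasWeakDifferential`).

Quasi-submultiplicativity splits `Θ⁻¹` of the right-hand side into a factor that depends on the
energy, at most linearly, and `Θ⁻¹ (δ ^ (-n))`. This gives the modulus `δ Θ⁻¹ (δ ^ (-n))`, made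
monotone by an infimum, which changes it by at most a constant factor because `q ≤ 1 / n`
(`exists_rawModulus_le`). The substitution `δ = Θ(s) ^ (-1/n)` turns the Osgood integral of the
modulus into `(1/n) ∫ Θ' / (s Θ)`, which diverges (`lintegral_osgoodModulus`). Applied at almost
every time, the estimate yields the continuous representative and the Osgood estimate with a locally
integrable `φ`.

Solutions exist by Carathéodory's theorem (`IsCaratheodoryOn.exists_isSolutionNear`): solve the
equation with a small delay and pass to the limit by the Arzelà–Ascoli theorem. The dominating
function is the mean of `|b|` over a ball plus a multiple of `φ` in the interior of the time
interval, and the given bound `m` at its endpoints. Uniqueness is Osgood's lemma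
(`IsOsgoodModulus.nonpos_of_sub_le`): while the distance of two solutions grows from `r / 2` to `r`,
the integral of `φ` grows by at least `(r / 2) / ω r`, and the sum of these numbers over dyadic `r`
diverges. Local uniqueness becomes uniqueness on the whole interval by connectedness.
-/

/-! ### The growth function and the Osgood modulus -/

/-- A growth function on the whole line with the properties of `Θ` used in the estimates: `Φ` is
positive, continuous and non-decreasing, and `Φ ^ q` is convex for an exponent `0 < q < 1 / n`
(or `q = 1` in dimension one). -/
structure IsGrowthFunction (n : ℕ) (q : ℝ) (Φ : ℝ → ℝ) : Prop where
  pos : ∀ s, 0 < Φ s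
  mono : Monotone Φ
  cont : Continuous Φ
  q_pos : 0 < q
  q_le : q ≤ 1
  q_cases : (n = 1 ∧ q = 1) ∨ n * q < 1
  convex_rpow : ConvexOn ℝ univ (fun s => Φ s ^ q)

lemma IsGrowthFunction.mul_q_le {n : ℕ} {q : ℝ} {Φ : ℝ → ℝ} (h : IsGrowthFunction n q Φ) :
    n * q ≤ 1 := by
  rcases h.q_cases with ⟨rfl, rfl⟩ | h
  · simp
  · exact h.le

/-- If a power `q ≤ 1` of a positive function is convex, so is the function. -/
lemma IsGrowthFunction.convex {n : ℕ} {q : ℝ} {Φ : ℝ → ℝ} (h : IsGrowthFunction n q Φ) :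
    ConvexOn ℝ univ Φ := by
  have himg : (fun s => Φ s ^ q) '' univ ⊆ Ici 0 := by
    rintro _ ⟨s, -, rfl⟩
    exact Real.rpow_nonneg (h.pos s).le _
  have hconv : Convex ℝ ((fun s => Φ s ^ q) '' univ) := by
    rw [image_univ]
    refine (isPreconnected_range ?_).ordConnected.convex
    exact h.cont.rpow_const fun s => Or.inl (h.pos s).ne'
  have := ((convexOn_rpow (p := 1 / q) (by rw [le_div_iff₀ h.q_pos]; linarith [h.q_le])).subset
    himg hconv).comp h.convex_rpow
    ((Real.monotoneOn_rpow_Ici_of_exponent_nonneg (by have := h.q_pos; positivity)).mono himg)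
  convert! this using 1
  ext s
  simp only [Function.comp]
  rw [← Real.rpow_mul (h.pos s).le, mul_one_div_cancel h.q_pos.ne', Real.rpow_one]

/-- Extending `Θ` by the constant `Θ 0` to the left of the origin gives a growth function. -/
lemma IsAdmissibleTheta.exists_isGrowthFunction {n : ℕ} (hn : 1 ≤ n) {Θ : ℝ → ℝ}
    (hΘ : IsAdmissibleTheta n Θ) :
    ∃ q, IsGrowthFunction n q (fun s => Θ (max s 0)) := by
  have hmono : Monotone (fun s => Θ (max s 0)) := fun s t hst =>
    hΘ.monotoneOn (mem_Ici.2 (le_max_right _ _)) (mem_Ici.2 (le_max_right _ _))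
      (max_le_max hst le_rfl)
  have hcont : Continuous (fun s => Θ (max s 0)) :=
    hΘ.locallyLipschitzOn.continuousOn.comp_continuous (by fun_prop) fun s =>
      mem_Ici.2 (le_max_right _ _)
  have hpos : ∀ s, 0 < Θ (max s 0) := fun s => hΘ.pos _ (le_max_right _ _)
  have hconv : ∀ q : ℝ, 0 < q → ConvexOn ℝ (Ici 0) (fun s => Θ s ^ q) →
      ConvexOn ℝ univ (fun s => Θ (max s 0) ^ q) := by
    intro q hq hc
    have himg : (fun s : ℝ => max s 0) '' univ = Ici 0 := by
      ext s
      simp only [image_univ, mem_range, mem_Ici]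
      exact ⟨fun ⟨y, hy⟩ => hy ▸ le_max_right _ _, fun hs => ⟨s, max_eq_left hs⟩⟩
    have h1 : ConvexOn ℝ univ (fun s : ℝ => max s 0) :=
      (convexOn_id convex_univ).sup (convexOn_const 0 convex_univ)
    refine ConvexOn.comp (f := fun s : ℝ => max s 0) (g := fun s => Θ s ^ q)
      (by rwa [himg]) h1 ?_
    rw [himg]
    intro s hs t ht hst
    exact Real.rpow_le_rpow (hΘ.pos s hs).le (hΘ.monotoneOn hs ht hst) hq.le
  rcases hn.eq_or_lt with h1 | h1
  · refine ⟨1, hpos, hmono, hcont, one_pos, le_rfl, Or.inl ⟨h1.symm, rfl⟩, hconv 1 one_pos ?_⟩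
    simpa using hΘ.convex_of_eq_one h1.symm
  · obtain ⟨α, hα1, hα2, hα⟩ := hΘ.convex_of_one_lt h1
    have hα0 : 0 < α := by linarith
    have hn1 : (1 : ℝ) < n := by exact_mod_cast h1
    have hq : 0 < (α - 1) / α := div_pos (by linarith) hα0
    have hnq : n * ((α - 1) / α) < 1 := by
      rw [lt_div_iff₀ (by linarith)] at hα2
      rw [← mul_div_assoc, div_lt_one hα0]
      linarith
    refine ⟨_, hpos, hmono, hcont, hq, ?_, Or.inr hnq, hconv _ hq hα⟩
    rw [div_le_one hα0]
    linarith

/-- On `[C, ∞)` the function `Φ` is strictly increasing and quasi-submultiplicative, with values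
covering `[Φ C, ∞)` and inverse `h`. The threshold `C` is large enough that `Φ C` is at least `1` and
larger than `Φ 0`. -/
structure HasQuasiInverse (Φ : ℝ → ℝ) (C : ℝ) (h : ℝ → ℝ) : Prop where
  one_le : 1 ≤ C
  one_le_apply : 1 ≤ Φ C
  zero_lt : Φ 0 < Φ C
  strictMono : StrictMonoOn Φ (Ici C)
  submul : ∀ s₁ s₂, C ≤ s₁ → C ≤ s₂ → Φ s₁ * Φ s₂ ≤ Φ (C * s₁ * s₂)
  le_inv : ∀ N, Φ C ≤ N → C ≤ h N
  apply_inv : ∀ N, Φ C ≤ N → Φ (h N) = N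

lemma IsAdmissibleTheta.exists_hasQuasiInverse {n : ℕ} {Θ : ℝ → ℝ} (hΘ : IsAdmissibleTheta n Θ) :
    ∃ C h, HasQuasiInverse (fun s => Θ (max s 0)) C h := by
  obtain ⟨C, hC, hbij, hsub⟩ := hΘ.quasi_submultiplicative
  have heq : ∀ s, C ≤ s → Θ (max s 0) = Θ s := fun s hs => by
    rw [max_eq_left (by linarith : (0 : ℝ) ≤ s)]
  obtain ⟨C', hC', hval⟩ := hbij.surjOn (show max 1 (Θ C) + 1 ∈ Ici (Θ C) by
    rw [mem_Ici]
    linarith [le_max_right 1 (Θ C)])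
  have hC'C : C ≤ C' := hC'
  have hsm : StrictMonoOn Θ (Ici C) := by
    intro s hs t ht hst
    have hs' : C ≤ s := hs
    have ht' : C ≤ t := ht
    refine lt_of_le_of_ne (hΘ.monotoneOn (mem_Ici.2 (by linarith)) (mem_Ici.2 (by linarith))
      hst.le) fun h => hst.ne (hbij.injOn hs ht h)
  have hinv : ∀ N, Θ C' ≤ N → ∃ s, C' ≤ s ∧ Θ s = N := by
    intro N hN
    obtain ⟨s, hs, hsN⟩ := hbij.surjOn (show N ∈ Ici (Θ C) from
      (hsm.monotoneOn self_mem_Ici hC' hC'C).trans hN)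
    refine ⟨s, ?_, hsN⟩
    by_contra! hlt
    have := hsm hs hC' hlt
    linarith
  choose! h hh1 hh2 using hinv
  -- the new threshold `C'` is a point where `Θ` takes the value `max 1 (Θ C) + 1`
  have h1 : max 1 (Θ C) + 1 ≤ Θ C' := hval.ge
  refine ⟨C', h, ⟨hC.trans hC'C, ?_, ?_, ?_, ?_, ?_, ?_⟩⟩
  · rw [heq _ hC'C]
    linarith [le_max_left 1 (Θ C)]
  · rw [heq _ hC'C, max_self]
    have : Θ 0 ≤ Θ C := hΘ.monotoneOn self_mem_Ici (mem_Ici.2 (by linarith)) (by linarith)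
    linarith [le_max_right 1 (Θ C)]
  · intro s hs t ht hst
    have hs' : C ≤ s := hC'C.trans hs
    have ht' : C ≤ t := hC'C.trans ht
    simpa only [heq _ hs', heq _ ht'] using hsm hs' ht' hst
  · intro s t hs ht
    have hs' : C ≤ s := hC'C.trans hs
    have ht' : C ≤ t := hC'C.trans ht
    have hst : 0 ≤ s * t := by nlinarith
    simp only [heq _ hs', heq _ ht']
    refine (hsub s t hs' ht').trans (hΘ.monotoneOn ?_ (mem_Ici.2 (le_max_right _ _))
      (le_max_of_le_left ?_))
    · rw [mem_Ici, mul_assoc]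
      nlinarith
    · rw [mul_assoc, mul_assoc]
      nlinarith
  · intro N hN
    exact hh1 N (by rwa [heq _ hC'C] at hN)
  · intro N hN
    rw [heq _ hC'C] at hN
    simp only [heq _ (hC'C.trans (hh1 N hN)), hh2 N hN]

/-- The integral of `Θ' / (s Θ)` diverges at infinity: over a bounded interval it is finite. -/
lemma IsAdmissibleTheta.lintegral_Ioi_eq_top {n : ℕ} {Θ : ℝ → ℝ} (hΘ : IsAdmissibleTheta n Θ)
    {C : ℝ} (hC : 1 ≤ C) :
    ∫⁻ s in Ioi C, ENNReal.ofReal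
      (deriv (fun s => Θ (max s 0)) s / (s * Θ (max s 0))) = ⊤ := by
  set Φ : ℝ → ℝ := fun s => Θ (max s 0) with hΦ
  have hmono : Monotone Φ := fun s t hst =>
    hΘ.monotoneOn (mem_Ici.2 (le_max_right _ _)) (mem_Ici.2 (le_max_right _ _))
      (max_le_max hst le_rfl)
  have htop : ∫⁻ s in Ioi (1 : ℝ), ENNReal.ofReal (deriv Φ s / (s * Φ s)) = ⊤ := by
    rw [← hΘ.integral_eq_top]
    refine setLIntegral_congr_fun measurableSet_Ioi fun s hs => ?_
    have hs0 : (0 : ℝ) < s := one_pos.trans hs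
    have he : Φ =ᶠ[𝓝 s] Θ := by
      filter_upwards [lt_mem_nhds hs0] with t ht
      simp only [hΦ, max_eq_left ht.le]
    rw [he.deriv_eq, he.eq_of_nhds]
  rw [← Ioc_union_Ioi_eq_Ioi hC, lintegral_union measurableSet_Ioi
    (Ioc_disjoint_Ioi le_rfl), ENNReal.add_eq_top] at htop
  refine htop.resolve_left (ne_of_lt ?_)
  have hint : IntegrableOn (deriv Φ) (Ioc 1 C) :=
    (intervalIntegrable_iff_integrableOn_Ioc_of_le hC).1
      (MonotoneOn.intervalIntegrable_deriv (hmono.monotoneOn _))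
  have hfin := (hint.div_const (Φ 0)).lintegral_lt_top
  refine lt_of_le_of_lt (setLIntegral_mono' measurableSet_Ioc fun s hs => ?_) hfin
  have h0 : 0 < Φ 0 := hΘ.pos _ (le_max_right _ _)
  have h1 : Φ 0 ≤ Φ s := hmono (by linarith [hs.1])
  refine ENNReal.ofReal_le_ofReal ?_
  refine div_le_div_of_nonneg_left hmono.deriv_nonneg h0 ?_
  nlinarith [hs.1]

/-- Convexity of `Φ ^ q` bounds the growth of the inverse of `Φ` from above. -/
lemma IsGrowthFunction.exists_ratio_le {n : ℕ} {q : ℝ} {Φ : ℝ → ℝ} (hΦ : IsGrowthFunction n q Φ)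
    {C : ℝ} (hC : 0 < C) (h0 : Φ 0 < Φ C) :
    ∃ K > 0, ∀ s' s, C ≤ s' → s' ≤ s → s ≤ K * s' * (Φ s / Φ s') ^ q := by
  have hf0 : 0 < Φ 0 ^ q := Real.rpow_pos_of_pos (hΦ.pos 0) q
  have hf : Φ 0 ^ q < Φ C ^ q := Real.rpow_lt_rpow (hΦ.pos 0).le h0 hΦ.q_pos
  have hfC := hf0.trans hf
  have hk : 0 < 1 - Φ 0 ^ q / Φ C ^ q := by
    rw [sub_pos, div_lt_one hfC]
    exact hf
  refine ⟨1 / (1 - Φ 0 ^ q / Φ C ^ q), by positivity, fun s' s hs' hs => ?_⟩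
  set k := Φ 0 ^ q / Φ C ^ q
  have hs'0 : 0 < s' := by linarith
  have hs0 : 0 < s := by linarith
  have hsec := hΦ.convex_rpow.secant_mono (a := 0) (x := s') (y := s) (mem_univ _) (mem_univ _)
    (mem_univ _) hs'0.ne' hs0.ne' hs
  simp only [sub_zero] at hsec
  rw [div_le_div_iff₀ hs'0 hs0] at hsec
  have hfs' : Φ C ^ q ≤ Φ s' ^ q := Real.rpow_le_rpow (hΦ.pos C).le (hΦ.mono hs') hΦ.q_pos.le
  have hfs'0 : 0 < Φ s' ^ q := by linarith
  have h3 : Φ 0 ^ q ≤ k * Φ s' ^ q := by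
    calc Φ 0 ^ q = k * Φ C ^ q := by rw [div_mul_cancel₀ _ hfC.ne']
      _ ≤ _ := by gcongr
  have h4 : s * ((1 - k) * Φ s' ^ q) ≤ s' * Φ s ^ q := by nlinarith
  rw [Real.div_rpow (hΦ.pos s).le (hΦ.pos s').le]
  rw [show 1 / (1 - k) * s' * (Φ s ^ q / Φ s' ^ q) = s' * Φ s ^ q / ((1 - k) * Φ s' ^ q) by
    field_simp, le_div_iff₀ (by positivity)]
  exact h4

/-- An unbounded convex function grows at least linearly. -/
lemma IsGrowthFunction.exists_le_mul {n : ℕ} {q : ℝ} {Φ : ℝ → ℝ} (hΦ : IsGrowthFunction n q Φ)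
    {C : ℝ} (hC : 0 < C) (h0 : Φ 0 < Φ C) : ∃ B > 0, ∀ s, C ≤ s → s ≤ B * Φ s := by
  have hpos : 0 < Φ C - Φ 0 := by linarith
  refine ⟨C / (Φ C - Φ 0), by positivity, fun s hs => ?_⟩
  have hs0 : 0 < s := by linarith
  have hsec := hΦ.convex.secant_mono (a := 0) (x := C) (y := s) (mem_univ _) (mem_univ _)
    (mem_univ _) hC.ne' hs0.ne' hs
  simp only [sub_zero] at hsec
  rw [div_le_div_iff₀ hC hs0] at hsec
  rw [div_mul_eq_mul_div, le_div_iff₀ hpos]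
  nlinarith [hΦ.pos 0]

/-- The function `δ ↦ δ Φ⁻¹(δ⁻ⁿ)`, where `h` is an inverse of `Φ` on `[C, ∞)`. -/
noncomputable def rawModulus (n : ℕ) (Φ : ℝ → ℝ) (C : ℝ) (h : ℝ → ℝ) (δ : ℝ) : ℝ :=
  δ * h (max (δ ^ n)⁻¹ (Φ C))

/-- The largest non-decreasing minorant of `rawModulus` on `[0, ∞)`. -/
noncomputable def osgoodModulus (n : ℕ) (Φ : ℝ → ℝ) (C : ℝ) (h : ℝ → ℝ) (δ : ℝ) : ℝ :=
  sInf (rawModulus n Φ C h '' Ici δ)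

section Modulus

variable {n : ℕ} {q : ℝ} {Φ h : ℝ → ℝ} {C : ℝ}

lemma HasQuasiInverse.le_rawModulus (hh : HasQuasiInverse Φ C h) {δ : ℝ} (hδ : 0 ≤ δ) :
    δ ≤ rawModulus n Φ C h δ := by
  have := hh.le_inv _ (le_max_right (δ ^ n)⁻¹ (Φ C))
  have := hh.one_le
  unfold rawModulus
  nlinarith

lemma HasQuasiInverse.bddBelow (hh : HasQuasiInverse Φ C h) {δ : ℝ} (hδ : 0 ≤ δ) :
    BddBelow (rawModulus n Φ C h '' Ici δ) := by
  refine ⟨0, ?_⟩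
  rintro _ ⟨δ', hδ', rfl⟩
  have h0 : 0 ≤ δ' := hδ.trans hδ'
  exact h0.trans (hh.le_rawModulus h0)

lemma HasQuasiInverse.osgoodModulus_le (hh : HasQuasiInverse Φ C h) {δ : ℝ} (hδ : 0 ≤ δ) :
    osgoodModulus n Φ C h δ ≤ rawModulus n Φ C h δ :=
  csInf_le (hh.bddBelow hδ) ⟨δ, self_mem_Ici, rfl⟩

lemma HasQuasiInverse.le_osgoodModulus (hh : HasQuasiInverse Φ C h) {δ : ℝ} (hδ : 0 ≤ δ) :
    δ ≤ osgoodModulus n Φ C h δ := by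
  refine le_csInf ⟨_, δ, self_mem_Ici, rfl⟩ ?_
  rintro _ ⟨δ', hδ', rfl⟩
  have h1 : δ ≤ δ' := hδ'
  exact h1.trans (hh.le_rawModulus (hδ.trans h1))

/-- `rawModulus` is non-decreasing up to a constant factor, because `q ≤ 1 / n`. -/
lemma exists_rawModulus_le (hΦ : IsGrowthFunction n q Φ) (hh : HasQuasiInverse Φ C h) :
    ∃ K > 0, ∀ δ, 0 < δ → rawModulus n Φ C h δ ≤ K * osgoodModulus n Φ C h δ := by
  have hC0 : 0 < C := by linarith [hh.one_le]
  obtain ⟨K, hK, hKs⟩ := hΦ.exists_ratio_le hC0 hh.zero_lt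
  refine ⟨K, hK, fun δ hδ => ?_⟩
  rw [← div_le_iff₀' hK]
  refine le_csInf ⟨_, δ, self_mem_Ici, rfl⟩ ?_
  rintro _ ⟨δ', hδ', rfl⟩
  have hle : δ ≤ δ' := hδ'
  have hδ'0 : 0 < δ' := hδ.trans_le hle
  rw [div_le_iff₀' hK]
  unfold rawModulus
  set N := max (δ ^ n)⁻¹ (Φ C) with hN
  set N' := max (δ' ^ n)⁻¹ (Φ C) with hN'
  have hNC : Φ C ≤ N := le_max_right _ _
  have hNC' : Φ C ≤ N' := le_max_right _ _
  have hN'0 : 0 < N' := (hΦ.pos C).trans_le hNC'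
  have hNN : N' ≤ N := by
    refine max_le_max ?_ le_rfl
    gcongr
  have hss : h N' ≤ h N := by
    by_contra! hlt
    have := hh.strictMono (hh.le_inv _ hNC) (hh.le_inv _ hNC') hlt
    rw [hh.apply_inv _ hNC, hh.apply_inv _ hNC'] at this
    linarith
  have h1 := hKs _ _ (hh.le_inv _ hNC') hss
  rw [hh.apply_inv _ hNC, hh.apply_inv _ hNC'] at h1
  have hρ : 1 ≤ δ' / δ := by rwa [one_le_div hδ]
  have hpow : (δ ^ n)⁻¹ = (δ' / δ) ^ n * (δ' ^ n)⁻¹ := by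
    rw [div_pow, div_mul_eq_mul_div, mul_inv_cancel₀ (by positivity), one_div]
  have h2 : N / N' ≤ (δ' / δ) ^ n := by
    rw [div_le_iff₀ hN'0]
    refine max_le ?_ ?_
    · calc (δ ^ n)⁻¹ = (δ' / δ) ^ n * (δ' ^ n)⁻¹ := hpow
        _ ≤ _ := by gcongr; exact le_max_left _ _
    · calc Φ C ≤ N' := hNC'
        _ ≤ _ := le_mul_of_one_le_left hN'0.le (one_le_pow₀ hρ)
  have h3 : (N / N') ^ q ≤ δ' / δ := by
    calc (N / N') ^ q ≤ ((δ' / δ) ^ n) ^ q :=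
          Real.rpow_le_rpow (div_nonneg ((hΦ.pos C).le.trans hNC) hN'0.le) h2 hΦ.q_pos.le
      _ = (δ' / δ) ^ (n * q) := by rw [← Real.rpow_natCast, ← Real.rpow_mul (by linarith)]
      _ ≤ (δ' / δ) ^ (1 : ℝ) := Real.rpow_le_rpow_of_exponent_le hρ hΦ.mul_q_le
      _ = _ := Real.rpow_one _
  have hs' : 0 < h N' := hC0.trans_le (hh.le_inv _ hNC')
  calc δ * h N ≤ δ * (K * h N' * (N / N') ^ q) := by gcongr
    _ ≤ δ * (K * h N' * (δ' / δ)) := by gcongr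
    _ = K * (δ' * h N') := by field_simp

/-- The Osgood condition: the change of variables `δ = Φ(s) ^ (-1/n)` turns `∫ dδ / (δ Φ⁻¹(δ⁻ⁿ))`
into `(1/n) ∫ Φ'(s) / (s Φ(s)) ds`. -/
lemma lintegral_osgoodModulus (hn : 1 ≤ n) (hΦ : IsGrowthFunction n q Φ)
    (hh : HasQuasiInverse Φ C h)
    (htop : ∫⁻ s in Ioi C, ENNReal.ofReal (deriv Φ s / (s * Φ s)) = ⊤) :
    ∫⁻ δ in Ioo (0 : ℝ) 1, ENNReal.ofReal (1 / osgoodModulus n Φ C h δ) = ⊤ := by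
  have hn0 : (0 : ℝ) < n := by exact_mod_cast hn
  have hC0 : 0 < C := by linarith [hh.one_le]
  set S : Set ℝ := Ioi C ∩ {s | DifferentiableAt ℝ Φ s} with hS
  have hSm : MeasurableSet S := measurableSet_Ioi.inter (measurableSet_of_differentiableAt ℝ Φ)
  have hSI : S =ᵐ[volume] Ioi C := by
    filter_upwards [hΦ.mono.ae_differentiableAt] with s hs
    exact propext ⟨fun h => h.1, fun h => ⟨h, hs⟩⟩
  rw [← setLIntegral_congr hSI] at htop
  set g : ℝ → ℝ := fun s => Φ s ^ (-(1 / n : ℝ)) with hg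
  have hgpos : ∀ s, 0 < g s := fun s => Real.rpow_pos_of_pos (hΦ.pos s) _
  have hgn : ∀ s, (g s ^ n)⁻¹ = Φ s := by
    intro s
    rw [hg, ← Real.rpow_natCast, ← Real.rpow_mul (hΦ.pos s).le, neg_mul,
      one_div_mul_cancel hn0.ne', Real.rpow_neg_one, inv_inv]
  have hginj : InjOn g S := by
    intro s hs t ht hst
    refine hh.strictMono.injOn (mem_Ici.2 hs.1.le) (mem_Ici.2 ht.1.le) ?_
    rw [← hgn s, ← hgn t, hst]
  have hgder : ∀ s ∈ S, HasDerivWithinAt g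
      (deriv Φ s * (-(1 / n : ℝ)) * Φ s ^ (-(1 / n : ℝ) - 1)) S s := fun s hs =>
    (hs.2.hasDerivAt.rpow_const (Or.inl (hΦ.pos s).ne')).hasDerivWithinAt
  have himg : g '' S ⊆ Ioo 0 1 := by
    rintro _ ⟨s, hs, rfl⟩
    refine ⟨hgpos s, Real.rpow_lt_one_of_one_lt_of_neg ?_ (by rw [neg_lt_zero]; positivity)⟩
    exact hh.one_le_apply.trans_lt (hh.strictMono self_mem_Ici (mem_Ici.2 hs.1.le) hs.1)
  refine top_unique ?_
  calc (⊤ : ENNReal) = ENNReal.ofReal (1 / n) * ⊤ := by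
        rw [ENNReal.mul_top (by simpa using Nat.one_le_iff_ne_zero.1 hn)]
    _ = ∫⁻ s in S, ENNReal.ofReal (1 / n) * ENNReal.ofReal (deriv Φ s / (s * Φ s)) := by
        rw [lintegral_const_mul' _ _ ENNReal.ofReal_ne_top, htop]
    _ = ∫⁻ s in S, ENNReal.ofReal |deriv Φ s * (-(1 / n : ℝ)) * Φ s ^ (-(1 / n : ℝ) - 1)| *
          ENNReal.ofReal (1 / rawModulus n Φ C h (g s)) := by
        refine setLIntegral_congr_fun hSm fun s hs => ?_
        have hs0 : 0 < s := hC0.trans hs.1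
        have hΦC : Φ C ≤ Φ s := hΦ.mono hs.1.le
        have hinv : h (Φ s) = s := by
          refine hh.strictMono.injOn (mem_Ici.2 (hh.le_inv _ hΦC)) (mem_Ici.2 hs.1.le) ?_
          rw [hh.apply_inv _ hΦC]
        have hraw : rawModulus n Φ C h (g s) = g s * s := by
          rw [rawModulus, hgn, max_eq_left hΦC, hinv]
        rw [← ENNReal.ofReal_mul (by positivity), ← ENNReal.ofReal_mul (abs_nonneg _), hraw]
        congr 1
        have hd : 0 ≤ deriv Φ s := hΦ.mono.deriv_nonneg
        have hp := hΦ.pos s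
        rw [abs_mul, abs_mul, abs_neg, abs_of_nonneg hd, abs_of_pos (by positivity : 0 < 1 / (n:ℝ)),
          abs_of_pos (Real.rpow_pos_of_pos hp _), Real.rpow_sub_one hp.ne']
        have hgs := hgpos s
        change _ = _ * _ * (g s / _) * _
        field_simp
    _ = ∫⁻ δ in g '' S, ENNReal.ofReal (1 / rawModulus n Φ C h δ) :=
        (lintegral_image_eq_lintegral_abs_deriv_mul hSm hgder hginj
          fun δ => ENNReal.ofReal (1 / rawModulus n Φ C h δ)).symm
    _ ≤ ∫⁻ δ in Ioo (0 : ℝ) 1, ENNReal.ofReal (1 / rawModulus n Φ C h δ) :=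
        lintegral_mono_set himg
    _ ≤ _ := by
        refine setLIntegral_mono' measurableSet_Ioo fun δ hδ => ENNReal.ofReal_le_ofReal ?_
        exact one_div_le_one_div_of_le (hδ.1.trans_le (hh.le_osgoodModulus hδ.1.le))
          (hh.osgoodModulus_le hδ.1.le)

lemma isOsgoodModulus_osgoodModulus (hn : 1 ≤ n) (hΦ : IsGrowthFunction n q Φ)
    (hh : HasQuasiInverse Φ C h)
    (htop : ∫⁻ s in Ioi C, ENNReal.ofReal (deriv Φ s / (s * Φ s)) = ⊤) :
    IsOsgoodModulus (osgoodModulus n Φ C h) where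
  monotoneOn δ hδ δ' _ hle :=
    csInf_le_csInf (hh.bddBelow hδ) ⟨_, δ', self_mem_Ici, rfl⟩
      (image_mono (Ici_subset_Ici.2 hle))
  zero := by
    refine le_antisymm ?_ (hh.le_osgoodModulus le_rfl)
    simpa [rawModulus] using hh.osgoodModulus_le (n := n) le_rfl
  pos δ hδ := hδ.trans_le (hh.le_osgoodModulus hδ.le)
  integral_eq_top := lintegral_osgoodModulus hn hΦ hh htop

/-- An estimate `Φ(κ d / δ) ≤ M Ψ / δⁿ` bounds `d` by `osgoodModulus`, with a constant that is
affine in `Ψ`: this is where the inverse of `Φ` is split by quasi-submultiplicativity. -/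
lemma exists_le_mul_osgoodModulus (hΦ : IsGrowthFunction n q Φ) (hh : HasQuasiInverse Φ C h)
    {M κ : ℝ} (hM : 0 < M) (hκ : 0 < κ) :
    ∃ A > 0, ∀ Ψ, 0 ≤ Ψ → ∀ δ, 0 < δ → ∀ d, Φ (κ * d / δ) ≤ M * Ψ / δ ^ n →
      d ≤ A * (1 + Ψ) * osgoodModulus n Φ C h δ := by
  have hC0 : 0 < C := by linarith [hh.one_le]
  obtain ⟨K, hK, hKle⟩ := exists_rawModulus_le hΦ hh
  obtain ⟨B, hB, hBle⟩ := hΦ.exists_le_mul hC0 hh.zero_lt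
  have hΦC := hΦ.pos C
  refine ⟨C / κ * (B * (M + Φ C)) * K, by positivity, fun Ψ hΨ δ hδ d hd => ?_⟩
  set P := max (M * Ψ) (Φ C) with hP
  set N := max (δ ^ n)⁻¹ (Φ C) with hN
  have hPC : Φ C ≤ P := le_max_right _ _
  have hNC : Φ C ≤ N := le_max_right _ _
  have hP1 := hh.le_inv _ hPC
  have hN1 := hh.le_inv _ hNC
  have hP0 : 0 < h P := hC0.trans_le hP1
  have hN0 : 0 < h N := hC0.trans_le hN1
  have hle : Φ (κ * d / δ) ≤ Φ (C * h P * h N) := by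
    calc Φ (κ * d / δ) ≤ (M * Ψ) * (δ ^ n)⁻¹ := hd
      _ ≤ P * N := by gcongr <;> exact le_max_left _ _
      _ = Φ (h P) * Φ (h N) := by rw [hh.apply_inv _ hPC, hh.apply_inv _ hNC]
      _ ≤ _ := hh.submul _ _ hP1 hN1
  have hCle : C ≤ C * h P * h N := by
    have h1 : 1 ≤ h P := hh.one_le.trans hP1
    have h2 : 1 ≤ h N := hh.one_le.trans hN1
    rw [mul_assoc]
    exact le_mul_of_one_le_right hC0.le (one_le_mul_of_one_le_of_one_le h1 h2)
  have hle' : κ * d / δ ≤ C * h P * h N := by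
    by_contra! hlt
    have := hh.strictMono (mem_Ici.2 hCle) (mem_Ici.2 (hCle.trans hlt.le)) hlt
    linarith
  have hPle : h P ≤ B * (M + Φ C) * (1 + Ψ) := by
    have h1 := hBle _ hP1
    rw [hh.apply_inv _ hPC] at h1
    have h2 : P ≤ (M + Φ C) * (1 + Ψ) := max_le (by nlinarith) (by nlinarith)
    calc h P ≤ B * P := h1
      _ ≤ B * ((M + Φ C) * (1 + Ψ)) := by gcongr
      _ = _ := by ring
  have hraw : rawModulus n Φ C h δ = δ * h N := rfl
  calc d = κ * d / δ * (δ / κ) := by field_simp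
    _ ≤ C * h P * h N * (δ / κ) := by gcongr
    _ = C / κ * h P * rawModulus n Φ C h δ := by rw [hraw]; ring
    _ ≤ C / κ * (B * (M + Φ C) * (1 + Ψ)) * (K * osgoodModulus n Φ C h δ) := by
        gcongr
        · rw [hraw]; positivity
        · exact hKle δ hδ
    _ = _ := by ring

end Modulus

/-! ### A Morrey estimate for continuously differentiable functions -/

section Morrey

variable {n : ℕ}

/-- The mean value inequality in integral form along a segment. -/
lemma norm_sub_le_integral_segment {u : Eucl n → Eucl n} (hu : ContDiff ℝ 1 u) (x z : Eucl n) :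
    ‖u x - u z‖ ≤ ‖x - z‖ * ∫ s in Ioc (0 : ℝ) 1, ‖fderiv ℝ u (x + s • (z - x))‖ := by
  have hD : Continuous (fderiv ℝ u) := hu.continuous_fderiv one_ne_zero
  have hder : ∀ s ∈ uIcc (0 : ℝ) 1, HasDerivAt (fun s : ℝ => u (x + s • (z - x)))
      (fderiv ℝ u (x + s • (z - x)) (z - x)) s := by
    intro s _
    have h1 : HasDerivAt (fun s : ℝ => x + s • (z - x)) (z - x) s := by
      simpa using ((hasDerivAt_id s).smul_const (z - x)).const_add x
    exact ((hu.differentiable one_ne_zero _).hasFDerivAt.comp_hasDerivAt s h1)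
  have hc : Continuous fun s : ℝ => fderiv ℝ u (x + s • (z - x)) := by fun_prop
  have hcv : Continuous fun s : ℝ => fderiv ℝ u (x + s • (z - x)) (z - x) := by fun_prop
  have h := intervalIntegral.integral_eq_sub_of_hasDerivAt hder (hcv.intervalIntegrable 0 1)
  simp only [one_smul, zero_smul, add_zero, add_sub_cancel] at h
  rw [norm_sub_rev, ← h, intervalIntegral.integral_of_le zero_le_one, mul_comm,
    ← integral_mul_const]
  refine norm_integral_le_of_norm_le ?_ (Eventually.of_forall fun s => ?_)
  · exact ((hc.norm.mul continuous_const).integrableOn_Icc).mono_set Ioc_subset_Icc_self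
  · rw [norm_sub_rev x z]
    exact ContinuousLinearMap.le_opNorm _ _

/-- Contracting a closed ball towards one of its points `x` by the factor `s` costs a factor
`s ^ (-n)` in the integral of a nonnegative function. -/
lemma setIntegral_contraction_le {f : Eucl n → ℝ} (hf : Continuous f) (hf0 : ∀ z, 0 ≤ f z)
    {z₀ x : Eucl n} {r s : ℝ} (hx : x ∈ Metric.closedBall z₀ r) (hs : s ∈ Ioc (0 : ℝ) 1) :
    ∫ z in Metric.closedBall z₀ r, f (x + s • (z - x)) ≤
      (s ^ n)⁻¹ * ∫ z in Metric.closedBall z₀ r, f z := by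
  have h1 := Measure.setIntegral_comp_smul volume (fun w => f ((x - s • x) + w))
    (Metric.closedBall z₀ r) hs.1.ne'
  have h2 : ∀ z : Eucl n, x - s • x + s • z = x + s • (z - x) := fun z => by
    rw [smul_sub]; abel
  simp only [h2, finrank_euclideanSpace, Fintype.card_fin, smul_eq_mul] at h1
  rw [h1, abs_of_pos (inv_pos.2 (pow_pos hs.1 n))]
  have hs0 := hs.1
  gcongr
  rw [← (measurePreserving_add_left volume (x - s • x)).setIntegral_preimage_emb
    (measurableEmbedding_addLeft _) f]
  refine setIntegral_mono_set ?_ (Eventually.of_forall fun w => hf0 _) (LE.le.eventuallyLE ?_)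
  · refine ContinuousOn.integrableOn_compact ?_ (by fun_prop)
    exact (Homeomorph.addLeft (x - s • x)).isCompact_preimage.2 (isCompact_closedBall _ _)
  · rintro _ ⟨z, hz, rfl⟩
    rw [mem_preimage]
    dsimp only
    rw [h2]
    exact (convex_closedBall z₀ r).add_smul_sub_mem hx hz ⟨hs.1.le, hs.2⟩

variable {q : ℝ} {Φ : ℝ → ℝ}

/-- A value differs from the mean over a closed ball by at most an integral of means over contracted
balls of the norm of the differential. -/
lemma norm_sub_average_le_integral_average {u : Eucl n → Eucl n} (hu : ContDiff ℝ 1 u) {c : ℝ}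
    (hc : 0 < c) {z₀ x : Eucl n} {r : ℝ} (hr : 0 < r) (hx : x ∈ Metric.closedBall z₀ r) :
    c * ‖u x - ⨍ z in Metric.closedBall z₀ r, u z‖ / (2 * r) ≤
      ∫ s in Ioc (0 : ℝ) 1, ⨍ z in Metric.closedBall z₀ r,
        c * ‖fderiv ℝ u (x + s • (z - x))‖ := by
  set B := Metric.closedBall z₀ r with hB
  have hBc : IsCompact B := isCompact_closedBall _ _
  set V := volume.real B with hV
  have hVtop : volume B ≠ ⊤ := hBc.measure_lt_top.ne
  have hVzero : volume B ≠ 0 := (Metric.measure_closedBall_pos volume z₀ hr).ne'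
  have hVpos : 0 < V := ENNReal.toReal_pos hVzero hVtop
  have hD : Continuous (fderiv ℝ u) := hu.continuous_fderiv one_ne_zero
  set G : ℝ → Eucl n → ℝ := fun s z => c * ‖fderiv ℝ u (x + s • (z - x))‖ with hG
  have hcont : Continuous (Function.uncurry fun (z : Eucl n) (s : ℝ) => (2 * r / c) * G s z) := by
    simp only [hG, Function.uncurry_def]
    fun_prop
  have hui : IntegrableOn u B := hu.continuous.continuousOn.integrableOn_compact hBc
  have hci : IntegrableOn (fun _ => u x) B := continuousOn_const.integrableOn_compact hBc
  have e1 : u x - ⨍ z in B, u z = V⁻¹ • ∫ z in B, (u x - u z) := by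
    rw [integral_sub hci hui, setIntegral_const, smul_sub, ← hV, inv_smul_smul₀ hVpos.ne',
      setAverage_eq]
  have hint : Continuous (fun z => ∫ s in Icc (0 : ℝ) 1, (2 * r / c) * G s z) :=
    continuous_parametric_integral_of_continuous (μ := volume) hcont isCompact_Icc
  simp only [integral_Icc_eq_integral_Ioc] at hint
  have e2 : ‖∫ z in B, (u x - u z)‖ ≤
      ∫ z in B, ∫ s in Ioc (0 : ℝ) 1, (2 * r / c) * G s z := by
    refine norm_integral_le_of_norm_le (hint.continuousOn.integrableOn_compact hBc) ?_
    refine (ae_restrict_iff' hBc.measurableSet).2 (Eventually.of_forall fun z hz => ?_)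
    refine (norm_sub_le_integral_segment hu x z).trans ?_
    have hxz : ‖x - z‖ ≤ 2 * r := by
      rw [← dist_eq_norm]
      have := dist_triangle_right x z z₀
      rw [Metric.mem_closedBall] at hx
      have hz' : dist z z₀ ≤ r := hz
      linarith
    rw [integral_const_mul]
    calc ‖x - z‖ * ∫ s in Ioc (0 : ℝ) 1, ‖fderiv ℝ u (x + s • (z - x))‖
        ≤ 2 * r * ∫ s in Ioc (0 : ℝ) 1, ‖fderiv ℝ u (x + s • (z - x))‖ :=
          mul_le_mul_of_nonneg_right hxz (integral_nonneg fun s => norm_nonneg _)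
      _ = 2 * r / c * ∫ s in Ioc (0 : ℝ) 1, G s z := by
          simp only [hG]
          rw [integral_const_mul]
          field_simp
  have e3 : ∫ z in B, ∫ s in Ioc (0 : ℝ) 1, (2 * r / c) * G s z =
      ∫ s in Ioc (0 : ℝ) 1, ∫ z in B, (2 * r / c) * G s z := by
    refine integral_integral_swap ?_
    rw [Measure.prod_restrict]
    exact (hcont.continuousOn.integrableOn_compact (hBc.prod isCompact_Icc)).mono_set
      (prod_mono le_rfl Ioc_subset_Icc_self)
  have e4 : V⁻¹ * ∫ s in Ioc (0 : ℝ) 1, ∫ z in B, (2 * r / c) * G s z =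
      2 * r / c * ∫ s in Ioc (0 : ℝ) 1, ⨍ z in B, G s z := by
    simp only [setAverage_eq, smul_eq_mul, integral_const_mul]
    rw [← hV]
    ring
  have e5 : ‖u x - ⨍ z in B, u z‖ ≤ 2 * r / c * ∫ s in Ioc (0 : ℝ) 1, ⨍ z in B, G s z := by
    rw [e1, norm_smul, Real.norm_of_nonneg (inv_nonneg.2 hVpos.le), ← e4, ← e3]
    exact mul_le_mul_of_nonneg_left e2 (inv_nonneg.2 hVpos.le)
  rw [div_le_iff₀ (by positivity)]
  refine (mul_le_mul_of_nonneg_left e5 hc.le).trans_eq ?_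
  field_simp
  rfl

/-- The mean over a ball of the bound given by the fundamental theorem of calculus. Jensen's
inequality for `Φ` is applied on each contracted ball, and Jensen's inequality for `Φ ^ q` to the
remaining integral over the contraction factor `s`, where `s ^ (-n q)` is integrable. -/
lemma rpow_apply_norm_sub_average_le (hΦ : IsGrowthFunction n q Φ) (hnq : n * q < 1)
    {u : Eucl n → Eucl n} (hu : ContDiff ℝ 1 u) {c : ℝ} (hc : 0 < c) {z₀ x : Eucl n} {r : ℝ}
    (hr : 0 < r) (hx : x ∈ Metric.closedBall z₀ r) {Ψ : ℝ}
    (hΨ : ∫ z in Metric.closedBall z₀ r, Φ (c * ‖fderiv ℝ u z‖) ≤ Ψ) :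
    Φ (c * ‖u x - ⨍ z in Metric.closedBall z₀ r, u z‖ / (2 * r)) ^ q ≤
      (1 - n * q)⁻¹ * (Ψ / volume.real (Metric.closedBall z₀ r)) ^ q := by
  set B := Metric.closedBall z₀ r with hB
  have hBc : IsCompact B := isCompact_closedBall _ _
  set V := volume.real B with hV
  have hVtop : volume B ≠ ⊤ := hBc.measure_lt_top.ne
  have hVzero : volume B ≠ 0 := (Metric.measure_closedBall_pos volume z₀ hr).ne'
  have hVpos : 0 < V := ENNReal.toReal_pos hVzero hVtop
  have hD : Continuous (fderiv ℝ u) := hu.continuous_fderiv one_ne_zero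
  have hΦc := hΦ.cont
  have hΨ0 : 0 ≤ Ψ := le_trans (integral_nonneg fun z => (hΦ.pos _).le) hΨ
  set G : ℝ → Eucl n → ℝ := fun s z => c * ‖fderiv ℝ u (x + s • (z - x))‖ with hG
  have hGc : Continuous (Function.uncurry G) := by
    simp only [hG, Function.uncurry_def]
    fun_prop
  have hGs : ∀ s, Continuous (G s) := fun s => hGc.uncurry_left s
  set a : ℝ → ℝ := fun s => ⨍ z in B, G s z with ha
  have hac : Continuous a := by
    simp only [ha, setAverage_eq, smul_eq_mul]
    have hint : Continuous fun s => ∫ z in B, G s z :=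
      continuous_parametric_integral_of_continuous (μ := volume) hGc hBc
    exact continuous_const.mul hint
  have h1 : c * ‖u x - ⨍ z in B, u z‖ / (2 * r) ≤ ∫ s in Ioc (0 : ℝ) 1, a s :=
    norm_sub_average_le_integral_average hu hc hr hx
  -- Jensen's inequality on the contracted ball with factor `s`
  have h2 : ∀ s ∈ Ioc (0 : ℝ) 1, Φ (a s) ≤ (s ^ n)⁻¹ * (Ψ / V) := by
    intro s hs
    have j := hΦ.convex.map_set_average_le (μ := volume) (t := B) (f := G s) hΦc.continuousOn
      isClosed_univ hVzero hVtop (Eventually.of_forall fun _ => mem_univ _)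
      ((hGs s).continuousOn.integrableOn_compact hBc)
      ((hΦc.comp (hGs s)).continuousOn.integrableOn_compact hBc)
    refine j.trans ?_
    rw [setAverage_eq, smul_eq_mul, ← hV]
    have hcon := setIntegral_contraction_le (f := fun z => Φ (c * ‖fderiv ℝ u z‖))
      (by fun_prop) (fun z => (hΦ.pos _).le) hx hs
    have hsn : 0 < s ^ n := pow_pos hs.1 n
    calc V⁻¹ * ∫ z in B, Φ (G s z) ≤ V⁻¹ * ((s ^ n)⁻¹ * Ψ) := by
          refine mul_le_mul_of_nonneg_left (hcon.trans ?_) (by positivity)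
          gcongr
      _ = _ := by ring
  -- Jensen's inequality in `s`
  have h3 : Φ (∫ s in Ioc (0 : ℝ) 1, a s) ^ q ≤ ∫ s in Ioc (0 : ℝ) 1, Φ (a s) ^ q := by
    have hfc : Continuous fun s => Φ s ^ q := hΦc.rpow_const fun s => Or.inl (hΦ.pos s).ne'
    have j := hΦ.convex_rpow.map_set_average_le (μ := volume) (t := Ioc (0 : ℝ) 1) (f := a)
      hfc.continuousOn isClosed_univ (by simp) (by simp)
      (Eventually.of_forall fun _ => mem_univ _)
      (hac.integrableOn_Icc.mono_set Ioc_subset_Icc_self)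
      ((hfc.comp hac).integrableOn_Icc.mono_set Ioc_subset_Icc_self)
    simpa [setAverage_eq] using j
  have hpow : IntegrableOn (fun s : ℝ => s ^ (-(n * q))) (Ioc 0 1) :=
    (intervalIntegrable_iff_integrableOn_Ioc_of_le zero_le_one).1
      (intervalIntegral.intervalIntegrable_rpow' (by linarith))
  have h4 : ∫ s in Ioc (0 : ℝ) 1, Φ (a s) ^ q ≤
      ∫ s in Ioc (0 : ℝ) 1, s ^ (-(n * q)) * (Ψ / V) ^ q := by
    have hfc : Continuous fun s => Φ (a s) ^ q :=
      (hΦc.comp hac).rpow_const fun s => Or.inl (hΦ.pos _).ne'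
    refine setIntegral_mono_on (hfc.integrableOn_Icc.mono_set Ioc_subset_Icc_self)
      (hpow.mul_const _) measurableSet_Ioc fun s hs => ?_
    refine (Real.rpow_le_rpow (hΦ.pos _).le (h2 s hs) hΦ.q_pos.le).trans_eq ?_
    have hs0 := hs.1
    rw [Real.mul_rpow (by positivity) (by positivity), Real.inv_rpow (by positivity),
      ← Real.rpow_natCast, ← Real.rpow_mul hs0.le, Real.rpow_neg hs0.le]
  have h5 : ∫ s in Ioc (0 : ℝ) 1, s ^ (-(n * q)) * (Ψ / V) ^ q =
      (1 - n * q)⁻¹ * (Ψ / V) ^ q := by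
    rw [integral_mul_const, ← intervalIntegral.integral_of_le zero_le_one,
      integral_rpow (Or.inl (by linarith)), Real.one_rpow, Real.zero_rpow (by linarith),
      sub_zero, one_div, neg_add_eq_sub]
  calc _ ≤ Φ (∫ s in Ioc (0 : ℝ) 1, a s) ^ q :=
        Real.rpow_le_rpow (hΦ.pos _).le (hΦ.mono h1) hΦ.q_pos.le
    _ ≤ _ := h3.trans (h4.trans_eq h5)

/-- In dimension one, an integral along a segment is an integral over a neighbourhood of it. -/
lemma integral_segment_le_of_dim_one {f : Eucl 1 → ℝ} (hf : Continuous f) (hf0 : ∀ z, 0 ≤ f z)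
    {x y : Eucl 1} (hxy : x ≠ y) {B : Set (Eucl 1)} (hB : IsCompact B) (hBc : Convex ℝ B)
    (hx : x ∈ B) (hy : y ∈ B) :
    ∫ s in Ioc (0 : ℝ) 1, f (x + s • (y - x)) ≤ ‖x - y‖⁻¹ * ∫ z in B, f z := by
  have hδ : 0 < ‖y - x‖ := norm_pos_iff.2 (sub_ne_zero.2 hxy.symm)
  set δ := ‖y - x‖ with hδdef
  set e : ℝ →ₗᵢ[ℝ] Eucl 1 := LinearIsometry.toSpanSingleton ℝ (Eucl 1)
    (v := δ⁻¹ • (y - x)) (by rw [norm_smul, norm_inv, norm_norm, inv_mul_cancel₀ hδ.ne']) with he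
  have hes : ∀ s, e s = s • (δ⁻¹ • (y - x)) := fun s => by
    simp [he, LinearIsometry.toSpanSingleton_apply]
  set e' : ℝ ≃ₗᵢ[ℝ] Eucl 1 := e.toLinearIsometryEquiv (by simp) with he'
  have he's : ∀ s, e' s = e s := fun s => rfl
  have hmp : MeasurePreserving (fun s => x + e' s) (volume : Measure ℝ) volume :=
    (measurePreserving_add_left volume x).comp e'.measurePreserving
  have hemb : MeasurableEmbedding (fun s => x + e' s) :=
    (measurableEmbedding_addLeft x).comp e'.toHomeomorph.measurableEmbedding
  have hcont : Continuous fun s => x + e' s := continuous_const.add e'.continuous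
  have h1 : ∀ s : ℝ, f (x + s • (y - x)) = f (x + e' (s * δ)) := fun s => by
    rw [he's, hes, smul_smul, mul_assoc, mul_inv_cancel₀ hδ.ne', mul_one]
  rw [← intervalIntegral.integral_of_le zero_le_one]
  simp only [h1]
  rw [intervalIntegral.integral_comp_mul_right (fun t => f (x + e' t)) hδ.ne', zero_mul, one_mul,
    smul_eq_mul, norm_sub_rev x y, intervalIntegral.integral_of_le hδ.le]
  refine mul_le_mul_of_nonneg_left ?_ (inv_nonneg.2 hδ.le)
  rw [← hmp.setIntegral_preimage_emb hemb f]
  refine setIntegral_mono_set ?_ (Eventually.of_forall fun w => hf0 _)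
    (LE.le.eventuallyLE ?_)
  · refine ContinuousOn.integrableOn_compact ?_ (by fun_prop)
    have : (fun s => x + e' s) ⁻¹' B = e'.toHomeomorph ⁻¹' (Homeomorph.addLeft x ⁻¹' B) := rfl
    rw [this]
    exact e'.toHomeomorph.isCompact_preimage.2 ((Homeomorph.addLeft x).isCompact_preimage.2 hB)
  · intro s hs
    rw [mem_preimage, he's, hes, smul_smul]
    refine hBc.add_smul_sub_mem hx hy ⟨mul_nonneg hs.1.le (inv_nonneg.2 hδ.le), ?_⟩
    rw [← div_eq_mul_inv, div_le_one hδ]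
    exact hs.2

/-- The Morrey estimate for continuously differentiable functions. -/
lemma exists_morrey_const (hΦ : IsGrowthFunction n q Φ) :
    ∃ M > 0, ∀ (u : Eucl n → Eucl n), ContDiff ℝ 1 u → ∀ c, 0 < c → ∀ x y, x ≠ y → ∀ Ψ : ℝ,
      ∫ z in Metric.closedBall (midpoint ℝ x y) (‖x - y‖ / 2), Φ (c * ‖fderiv ℝ u z‖) ≤ Ψ →
      Φ (c / 2 * ‖u x - u y‖ / ‖x - y‖) ≤ M * Ψ / ‖x - y‖ ^ n := by
  rcases hΦ.q_cases with ⟨rfl, rfl⟩ | hnq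
  · refine ⟨1, one_pos, fun u hu c hc x y hxy Ψ hΨ => ?_⟩
    have hδ : 0 < ‖x - y‖ := norm_pos_iff.2 (sub_ne_zero.2 hxy)
    have hD : Continuous (fderiv ℝ u) := hu.continuous_fderiv one_ne_zero
    have hΦc := hΦ.cont
    have hGc : Continuous fun s : ℝ => c * ‖fderiv ℝ u (x + s • (y - x))‖ := by fun_prop
    have hx : x ∈ Metric.closedBall (midpoint ℝ x y) (‖x - y‖ / 2) := by
      rw [Metric.mem_closedBall, dist_left_midpoint, dist_eq_norm]
      norm_num
      linarith
    have hy : y ∈ Metric.closedBall (midpoint ℝ x y) (‖x - y‖ / 2) := by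
      rw [Metric.mem_closedBall, dist_right_midpoint, dist_eq_norm]
      norm_num
      linarith
    have h1 : c / 2 * ‖u x - u y‖ / ‖x - y‖ ≤
        ∫ s in Ioc (0 : ℝ) 1, c * ‖fderiv ℝ u (x + s • (y - x))‖ := by
      rw [div_le_iff₀ hδ, integral_const_mul]
      have := norm_sub_le_integral_segment hu x y
      have h0 := norm_nonneg (u x - u y)
      calc c / 2 * ‖u x - u y‖ ≤ c * ‖u x - u y‖ := by nlinarith
        _ ≤ c * (‖x - y‖ * ∫ s in Ioc (0 : ℝ) 1, ‖fderiv ℝ u (x + s • (y - x))‖) := by gcongr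
        _ = _ := by ring
    have h2 := hΦ.convex.map_set_average_le (μ := volume) (t := Ioc (0 : ℝ) 1)
      (f := fun s : ℝ => c * ‖fderiv ℝ u (x + s • (y - x))‖)
      hΦc.continuousOn isClosed_univ (by simp) (by simp)
      (Eventually.of_forall fun _ => mem_univ _)
      (hGc.integrableOn_Icc.mono_set Ioc_subset_Icc_self)
      ((hΦc.comp hGc).integrableOn_Icc.mono_set Ioc_subset_Icc_self)
    simp only [setAverage_eq, Real.volume_real_Ioc, sub_zero, zero_le_one, sup_of_le_left, inv_one,
      one_smul] at h2
    refine (hΦ.mono h1).trans (h2.trans ?_)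
    refine (integral_segment_le_of_dim_one (f := fun z => Φ (c * ‖fderiv ℝ u z‖)) (by fun_prop)
      (fun z => (hΦ.pos _).le) hxy (isCompact_closedBall _ _) (convex_closedBall _ _) hx hy).trans
      ?_
    rw [one_mul, pow_one, div_eq_inv_mul Ψ]
    exact mul_le_mul_of_nonneg_left hΨ (inv_nonneg.2 hδ.le)
  · set V₁ := volume.real (Metric.ball (0 : Eucl n) 1) with hV₁
    have hV₁pos : 0 < V₁ := ENNReal.toReal_pos
      (Metric.measure_ball_pos volume 0 one_pos).ne' measure_ball_lt_top.ne
    have hk : 0 < (1 - n * q)⁻¹ := inv_pos.2 (by linarith)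
    refine ⟨((1 - n * q)⁻¹) ^ (1 / q) * 2 ^ n / V₁, by positivity,
      fun u hu c hc x y hxy Ψ hΨ => ?_⟩
    have hδ : 0 < ‖x - y‖ := norm_pos_iff.2 (sub_ne_zero.2 hxy)
    set r := ‖x - y‖ / 2 with hr
    have hr0 : 0 < r := by positivity
    set z₀ := midpoint ℝ x y
    have hx : x ∈ Metric.closedBall z₀ r := by
      rw [Metric.mem_closedBall, dist_left_midpoint, dist_eq_norm]
      norm_num
      linarith
    have hy : y ∈ Metric.closedBall z₀ r := by
      rw [Metric.mem_closedBall, dist_right_midpoint, dist_eq_norm]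
      norm_num
      linarith
    have hΨ0 : 0 ≤ Ψ := le_trans (integral_nonneg fun z => (hΦ.pos _).le) hΨ
    set m := ⨍ z in Metric.closedBall z₀ r, u z
    -- one of the two points deviates from the mean by at least half the distance of the values
    obtain ⟨w, hw, hwd⟩ : ∃ w ∈ Metric.closedBall z₀ r, ‖u x - u y‖ / 2 ≤ ‖u w - m‖ := by
      by_contra! hcon
      have h1 := hcon x hx
      have h2 := hcon y hy
      have h3 := norm_sub_le_norm_sub_add_norm_sub (u x) m (u y)
      rw [norm_sub_rev m] at h3
      linarith
    have h1 := rpow_apply_norm_sub_average_le hΦ hnq hu hc hr0 hw hΨ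
    have hle : c / 2 * ‖u x - u y‖ / ‖x - y‖ ≤ c * ‖u w - m‖ / (2 * r) := by
      rw [hr, mul_div_cancel₀ _ (two_ne_zero)]
      refine div_le_div_of_nonneg_right ?_ hδ.le
      calc c / 2 * ‖u x - u y‖ = c * (‖u x - u y‖ / 2) := by ring
        _ ≤ _ := by gcongr
    rw [Measure.addHaar_real_closedBall _ _ hr0.le, finrank_euclideanSpace, Fintype.card_fin,
      ← hV₁] at h1
    refine (hΦ.mono hle).trans ?_
    have h2 := Real.rpow_le_rpow (Real.rpow_nonneg (hΦ.pos _).le _) h1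
      (by have := hΦ.q_pos; positivity : 0 ≤ 1 / q)
    have hΨV : 0 ≤ Ψ / (r ^ n * V₁) := by positivity
    rw [← Real.rpow_mul (hΦ.pos _).le, mul_one_div_cancel hΦ.q_pos.ne', Real.rpow_one,
      Real.mul_rpow hk.le (Real.rpow_nonneg hΨV _), ← Real.rpow_mul hΨV,
      mul_one_div_cancel hΦ.q_pos.ne', Real.rpow_one] at h2
    refine h2.trans_eq ?_
    rw [hr, div_pow]
    field_simp

end Morrey

/-! ### Mollification of weakly differentiable functions -/

section Mollification

open scoped Convolution

variable {n : ℕ} {Ω : Set (Eucl n)} {u : Eucl n → Eucl n} {D : Eucl n → Eucl n →L[ℝ] Eucl n}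

lemma HasWeakDifferential.integrable_indicator (h : HasWeakDifferential Ω u D) {K : Set (Eucl n)}
    (hK : IsCompact K) (hKΩ : K ⊆ Ω) : Integrable (K.indicator u) :=
  (integrable_indicator_iff hK.measurableSet).2
    (h.locallyIntegrableOn.integrableOn_compact_subset hKΩ hK)

/-- The directional derivative of a mollification, with the derivative on the kernel. -/
lemma fderiv_convolution_lsmul_apply {E F : Type*} [NormedAddCommGroup E] [InnerProductSpace ℝ E]
    [FiniteDimensional ℝ E] [MeasurableSpace E] [BorelSpace E] [NormedAddCommGroup F]
    [NormedSpace ℝ F] [CompleteSpace F] {f : E → ℝ} (hf : ContDiff ℝ 1 f)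
    (hfs : HasCompactSupport f) {g : E → F} (hg : LocallyIntegrable g) (z w : E) :
    fderiv ℝ (f ⋆[ContinuousLinearMap.lsmul ℝ ℝ, volume] g) z w =
      ∫ y, fderiv ℝ f (z - y) w • g y := by
  have hfd := hfs.hasFDerivAt_convolution_left (ContinuousLinearMap.lsmul ℝ ℝ) hf hg z
  have hex := ((hfs.fderiv ℝ).convolutionExists_left
    ((ContinuousLinearMap.lsmul ℝ ℝ : ℝ →L[ℝ] F →L[ℝ] F).precompL E)
    (hf.continuous_fderiv one_ne_zero) hg z).integrable_swap
  rw [hfd.fderiv, convolution_eq_swap, ContinuousLinearMap.integral_apply hex w]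
  simp only [ContinuousLinearMap.precompL_apply, ContinuousLinearMap.lsmul_apply]

lemma ContDiffBump.normed_sub_eq_zero (ρ : ContDiffBump (0 : Eucl n)) {y z : Eucl n}
    (hy : y ∉ Metric.closedBall z ρ.rOut) : ρ.normed volume (z - y) = 0 := by
  by_contra hne
  have : z - y ∈ Function.support (ρ.normed volume) := hne
  rw [ρ.support_normed_eq, mem_ball_zero_iff] at this
  exact hy (by rw [Metric.mem_closedBall, dist_comm, dist_eq_norm]; exact this.le)

/-- The differential of a mollification is the mollification of the weak differential. -/
lemma HasWeakDifferential.fderiv_convolution_apply (h : HasWeakDifferential Ω u D)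
    {K : Set (Eucl n)} (hK : IsCompact K) (hKΩ : K ⊆ Ω) (ρ : ContDiffBump (0 : Eucl n))
    {z : Eucl n} (hz : Metric.closedBall z ρ.rOut ⊆ K) (w : Eucl n) :
    fderiv ℝ (ρ.normed volume ⋆[ContinuousLinearMap.lsmul ℝ ℝ, volume] K.indicator u) z w =
      ∫ y in K, ρ.normed volume (z - y) • D y w := by
  have hU := h.integrable_indicator hK hKΩ
  have hρ : ContDiff ℝ 1 (ρ.normed volume) := ρ.contDiff_normed
  rw [fderiv_convolution_lsmul_apply hρ ρ.hasCompactSupport_normed hU.locallyIntegrable]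
  set η : Eucl n → ℝ := fun y => ρ.normed volume (z - y) with hη
  have hηsmooth : ContDiff ℝ ((⊤ : ℕ∞) : WithTop ℕ∞) η :=
    ρ.contDiff_normed.comp (contDiff_const.sub contDiff_id)
  have htsupp : tsupport η ⊆ Metric.closedBall z ρ.rOut :=
    closure_minimal (fun y hy => by_contra fun hn => hy (ρ.normed_sub_eq_zero hn))
      Metric.isClosed_closedBall
  have hηc : HasCompactSupport η :=
    HasCompactSupport.of_support_subset_isCompact (isCompact_closedBall z ρ.rOut)
      (subset_closure.trans htsupp)
  have hηd : ∀ y, fderiv ℝ η y w = - fderiv ℝ (ρ.normed volume) (z - y) w := by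
    intro y
    have h1 : HasFDerivAt η ((fderiv ℝ (ρ.normed volume) (z - y)).comp
        (-ContinuousLinearMap.id ℝ (Eucl n))) y := by
      refine ((hρ.differentiable one_ne_zero _).hasFDerivAt).comp y ?_
      exact (hasFDerivAt_id y).const_sub z
    rw [h1.fderiv, ContinuousLinearMap.comp_apply, neg_apply,
      ContinuousLinearMap.id_apply, map_neg]
  have hηdzero : ∀ y, y ∉ K → fderiv ℝ η y w = 0 := by
    intro y hy
    have h1 : y ∉ tsupport η := fun hy' => hy (hz (htsupp hy'))
    have h2 : fderiv ℝ η y = 0 :=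
      image_eq_zero_of_notMem_tsupport fun hy' => h1 (tsupport_fderiv_subset ℝ hy')
    rw [h2, zero_apply]
  have key := h.integral_eq η hηsmooth hηc (htsupp.trans (hz.trans hKΩ)) w
  have e1 : ∫ y in Ω, fderiv ℝ η y w • u y = ∫ y, fderiv ℝ η y w • K.indicator u y := by
    rw [← setIntegral_eq_integral_of_forall_compl_eq_zero (s := Ω)
      (f := fun y => fderiv ℝ η y w • K.indicator u y)]
    · refine integral_congr_ae (Eventually.of_forall fun y => ?_)
      by_cases hy : y ∈ K
      · simp [hy]
      · simp [hηdzero y hy]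
    · intro y hy
      rw [hηdzero y fun hy' => hy (hKΩ hy'), zero_smul]
  have e2 : ∫ y in Ω, η y • D y w = ∫ y in K, η y • D y w := by
    have hzero : ∀ y, y ∉ K → η y • D y w = 0 := fun y hy => by
      rw [show η y = 0 from ρ.normed_sub_eq_zero fun hy' => hy (hz hy'), zero_smul]
    rw [setIntegral_eq_integral_of_forall_compl_eq_zero hzero,
      setIntegral_eq_integral_of_forall_compl_eq_zero fun y hy => hzero y fun hy' => hy (hKΩ hy')]
  rw [e1, e2] at key
  rw [← neg_inj, ← key, ← integral_neg]
  simp only [hηd, neg_smul]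

/-- Jensen's inequality for the mollified differential. -/
lemma HasWeakDifferential.ofReal_fderiv_convolution_le (h : HasWeakDifferential Ω u D)
    {K : Set (Eucl n)} (hK : IsCompact K) (hKΩ : K ⊆ Ω) (ρ : ContDiffBump (0 : Eucl n))
    {z : Eucl n} (hz : Metric.closedBall z ρ.rOut ⊆ K) {q : ℝ} {Φ : ℝ → ℝ}
    (hΦ : IsGrowthFunction n q Φ) {c : ℝ} (hc : 0 < c)
    (hfin : ∫⁻ y in K, ENNReal.ofReal (Φ (c * ‖D y‖)) < ⊤) :
    ENNReal.ofReal (Φ (c * ‖fderiv ℝ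
      (ρ.normed volume ⋆[ContinuousLinearMap.lsmul ℝ ℝ, volume] K.indicator u) z‖)) ≤
      ∫⁻ y in K, ENNReal.ofReal (ρ.normed volume (z - y)) * ENNReal.ofReal (Φ (c * ‖D y‖)) := by
  have hDi : IntegrableOn D K := h.locallyIntegrableOn_diff.integrableOn_compact_subset hKΩ hK
  set η : Eucl n → ℝ := fun y => ρ.normed volume (z - y) with hη
  have hηc : Continuous η := ρ.continuous_normed.comp (continuous_const.sub continuous_id)
  have hη0 : ∀ y, 0 ≤ η y := fun y => ρ.nonneg_normed _
  obtain ⟨Cη, hCη⟩ : ∃ C, ∀ y, ‖η y‖ ≤ C := by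
    obtain ⟨C, hC⟩ := ρ.hasCompactSupport_normed.exists_bound_of_continuous
      (ρ.continuous_normed (μ := volume))
    exact ⟨C, fun y => hC _⟩
  have hηzero : ∀ y, y ∉ K → η y = 0 := fun y hy => ρ.normed_sub_eq_zero fun hy' => hy (hz hy')
  have hηint : ∫ y in K, η y = 1 := by
    rw [setIntegral_eq_integral_of_forall_compl_eq_zero hηzero]
    exact (integral_sub_left_eq_self (ρ.normed volume) volume z).trans ρ.integral_normed
  have hηi : IntegrableOn η K := hηc.continuousOn.integrableOn_compact hK
  set μ : Measure (Eucl n) := (volume.restrict K).withDensity fun y => ENNReal.ofReal (η y) with hμ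
  have hdm : Measurable fun y => ENNReal.ofReal (η y) := hηc.measurable.ennreal_ofReal
  have hprob : IsProbabilityMeasure μ := by
    constructor
    rw [hμ, withDensity_apply _ MeasurableSet.univ, Measure.restrict_univ,
      ← ofReal_integral_eq_lintegral_ofReal hηi (Eventually.of_forall hη0), hηint,
      ENNReal.ofReal_one]
  have hΦi : IntegrableOn (fun y => Φ (c * ‖D y‖)) K := by
    refine ⟨hΦ.cont.comp_aestronglyMeasurable (hDi.aestronglyMeasurable.norm.const_mul c), ?_⟩
    rw [hasFiniteIntegral_iff_ofReal (Eventually.of_forall fun y => (hΦ.pos _).le)]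
    exact hfin
  have htoReal : ∀ y, (ENNReal.ofReal (η y)).toReal = η y := fun y => ENNReal.toReal_ofReal (hη0 y)
  have hmulint : ∀ f : Eucl n → ℝ, IntegrableOn f K → IntegrableOn (fun y => η y * f y) K :=
    fun f hf => Integrable.bdd_mul hf hηc.aestronglyMeasurable (Eventually.of_forall hCη)
  have hint : ∀ f : Eucl n → ℝ, IntegrableOn f K → Integrable f μ ∧
      ∫ y, f y ∂μ = ∫ y in K, η y * f y := by
    intro f hf
    constructor
    · rw [hμ, integrable_withDensity_iff_integrable_smul' hdm
        (Eventually.of_forall fun y => ENNReal.ofReal_lt_top)]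
      simp only [htoReal]
      exact hmulint f hf
    · rw [hμ, integral_withDensity_eq_integral_toReal_smul hdm
        (Eventually.of_forall fun y => ENNReal.ofReal_lt_top)]
      simp only [htoReal, smul_eq_mul]
  obtain ⟨i1, e1⟩ := hint (fun y => c * ‖D y‖) (hDi.norm.const_mul c)
  obtain ⟨i2, e2⟩ := hint (fun y => Φ (c * ‖D y‖)) hΦi
  have jensen := hΦ.convex.map_integral_le hΦ.cont.continuousOn isClosed_univ
    (Eventually.of_forall fun _ => mem_univ _) i1 i2
  have hnorm : c * ‖fderiv ℝ
      (ρ.normed volume ⋆[ContinuousLinearMap.lsmul ℝ ℝ, volume] K.indicator u) z‖ ≤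
      ∫ y, c * ‖D y‖ ∂μ := by
    have e3 : ∫ y in K, η y * (c * ‖D y‖) = c * ∫ y in K, η y * ‖D y‖ := by
      rw [← integral_const_mul]
      refine integral_congr_ae (Eventually.of_forall fun y => ?_)
      ring
    rw [e1, e3]
    refine mul_le_mul_of_nonneg_left ?_ hc.le
    refine ContinuousLinearMap.opNorm_le_bound _
      (integral_nonneg fun y => mul_nonneg (hη0 y) (norm_nonneg _)) fun w => ?_
    rw [h.fderiv_convolution_apply hK hKΩ ρ hz w, ← integral_mul_const]
    refine norm_integral_le_of_norm_le ((hmulint _ hDi.norm).mul_const _)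
      (Eventually.of_forall fun y => ?_)
    rw [norm_smul, Real.norm_of_nonneg (hη0 y), mul_assoc]
    exact mul_le_mul_of_nonneg_left (ContinuousLinearMap.le_opNorm _ _) (hη0 y)
  calc _ ≤ ENNReal.ofReal (∫ y, Φ (c * ‖D y‖) ∂μ) :=
        ENNReal.ofReal_le_ofReal ((hΦ.mono hnorm).trans jensen)
    _ = ∫⁻ y in K, ENNReal.ofReal (η y * Φ (c * ‖D y‖)) := by
        rw [e2, ofReal_integral_eq_lintegral_ofReal]
        · exact hmulint _ hΦi
        · exact Eventually.of_forall fun y => mul_nonneg (hη0 y) (hΦ.pos _).le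
    _ = _ := by
        refine lintegral_congr fun y => ?_
        rw [ENNReal.ofReal_mul (hη0 y)]

/-- Mollification does not increase the Orlicz energy. -/
lemma HasWeakDifferential.setIntegral_fderiv_convolution_le (h : HasWeakDifferential Ω u D)
    {K : Set (Eucl n)} (hK : IsCompact K) (hKΩ : K ⊆ Ω) (ρ : ContDiffBump (0 : Eucl n))
    {B : Set (Eucl n)} (hB : ∀ z ∈ B, Metric.closedBall z ρ.rOut ⊆ K) (hBm : MeasurableSet B)
    {q : ℝ} {Φ : ℝ → ℝ} (hΦ : IsGrowthFunction n q Φ) {c : ℝ} (hc : 0 < c) {Ψ : ℝ} (hΨ0 : 0 ≤ Ψ)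
    (hΨ : ∫⁻ y in K, ENNReal.ofReal (Φ (c * ‖D y‖)) ≤ ENNReal.ofReal Ψ) :
    ∫ z in B, Φ (c * ‖fderiv ℝ
      (ρ.normed volume ⋆[ContinuousLinearMap.lsmul ℝ ℝ, volume] K.indicator u) z‖) ≤ Ψ := by
  have hDi : IntegrableOn D K := h.locallyIntegrableOn_diff.integrableOn_compact_subset hKΩ hK
  have hfin := hΨ.trans_lt ENNReal.ofReal_lt_top
  have hv : ContDiff ℝ 1
      (ρ.normed volume ⋆[ContinuousLinearMap.lsmul ℝ ℝ, volume] K.indicator u) :=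
    ρ.hasCompactSupport_normed.contDiff_convolution_left _ ρ.contDiff_normed
      (h.integrable_indicator hK hKΩ).locallyIntegrable
  have hcont := hΦ.cont.comp ((hv.continuous_fderiv one_ne_zero).norm.const_mul c)
  rw [integral_eq_lintegral_of_nonneg_ae (Eventually.of_forall fun z => (hΦ.pos _).le)
    hcont.aestronglyMeasurable]
  refine ENNReal.toReal_le_of_le_ofReal hΨ0 (le_trans ?_ hΨ)
  have hρm : Measurable (ρ.normed (volume : Measure (Eucl n))) := ρ.continuous_normed.measurable
  have hm2 : AEMeasurable (fun y => ENNReal.ofReal (Φ (c * ‖D y‖))) (volume.restrict K) :=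
    (hΦ.cont.measurable.comp_aemeasurable
      (hDi.aestronglyMeasurable.norm.aemeasurable.const_mul c)).ennreal_ofReal
  calc _ ≤ ∫⁻ z in B, ∫⁻ y in K, ENNReal.ofReal (ρ.normed volume (z - y)) *
          ENNReal.ofReal (Φ (c * ‖D y‖)) :=
        setLIntegral_mono' hBm fun z hz =>
          h.ofReal_fderiv_convolution_le hK hKΩ ρ (hB z hz) hΦ hc hfin
    _ = ∫⁻ y in K, ∫⁻ z in B, ENNReal.ofReal (ρ.normed volume (z - y)) *
          ENNReal.ofReal (Φ (c * ‖D y‖)) := by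
        refine lintegral_lintegral_swap ?_
        refine AEMeasurable.mul ?_ hm2.comp_snd
        exact (hρm.comp (measurable_fst.sub measurable_snd)).ennreal_ofReal.aemeasurable
    _ ≤ ∫⁻ y in K, ENNReal.ofReal (Φ (c * ‖D y‖)) := by
        refine lintegral_mono fun y => ?_
        rw [lintegral_mul_const' _ _ ENNReal.ofReal_ne_top]
        refine mul_le_of_le_one_left' ?_
        calc ∫⁻ z in B, ENNReal.ofReal (ρ.normed volume (z - y))
            ≤ ∫⁻ z, ENNReal.ofReal (ρ.normed volume (z - y)) := setLIntegral_le_lintegral _ _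
          _ = ∫⁻ z, ENNReal.ofReal (ρ.normed volume z) :=
              lintegral_sub_right_eq_self (fun z => ENNReal.ofReal (ρ.normed volume z)) y
          _ = 1 := by
              rw [← ofReal_integral_eq_lintegral_ofReal ρ.integrable_normed
                (Eventually.of_forall fun z => ρ.nonneg_normed z), ρ.integral_normed,
                ENNReal.ofReal_one]

/-- Two points of a ball of radius `R` and the ball having them as antipodal points: the latter
stays within distance `√2 R` of the centre. -/
lemma closedBall_midpoint_subset {o x y : Eucl n} {R : ℝ} (hx : x ∈ Metric.ball o R)
    (hy : y ∈ Metric.ball o R) :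
    Metric.closedBall (midpoint ℝ x y) (‖x - y‖ / 2) ⊆ Metric.closedBall o (1.42 * R) := by
  intro z hz
  rw [mem_ball_iff_norm] at hx hy
  have hpar := parallelogram_law_with_norm ℝ (x - o) (y - o)
  have h1 : x - o + (y - o) = (2 : ℝ) • (midpoint ℝ x y - o) := by
    rw [midpoint_eq_smul_add, smul_sub, smul_smul, two_smul]
    norm_num
    abel
  rw [h1, norm_smul, sub_sub_sub_cancel_right, Real.norm_ofNat] at hpar
  rw [Metric.mem_closedBall] at hz ⊢
  have h2 : dist z o ≤ ‖x - y‖ / 2 + ‖midpoint ℝ x y - o‖ := by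
    rw [← dist_eq_norm (midpoint ℝ x y) o]
    exact (dist_triangle _ _ _).trans (by gcongr)
  refine h2.trans ?_
  have hR : 0 < R := (norm_nonneg _).trans_lt hx
  have hx2 : ‖x - o‖ * ‖x - o‖ ≤ R * R := by gcongr
  have hy2 : ‖y - o‖ * ‖y - o‖ ≤ R * R := by gcongr
  refine abs_le_of_sq_le_sq' ?_ (by positivity) |>.2
  nlinarith [sq_nonneg (‖x - y‖ / 2 - ‖midpoint ℝ x y - o‖), sq_nonneg R]

/-- The Morrey estimate for weakly differentiable functions, on a set of full measure. -/
lemma exists_morrey_const_of_hasWeakDifferential {q : ℝ} {Φ : ℝ → ℝ}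
    (hΦ : IsGrowthFunction n q Φ) :
    ∃ M > 0, ∀ (Ω : Set (Eucl n)) (u : Eucl n → Eucl n) (D : Eucl n → Eucl n →L[ℝ] Eucl n),
      HasWeakDifferential Ω u D → ∀ c, 0 < c → ∀ o R, 0 < R → Metric.ball o (2 * R) ⊆ Ω →
      ∀ Ψ : ℝ, 0 ≤ Ψ →
      ∫⁻ z in Metric.ball o (2 * R), ENNReal.ofReal (Φ (c * ‖D z‖)) ≤ ENNReal.ofReal Ψ →
      ∃ E : Set (Eucl n), (∀ᵐ x, x ∈ E) ∧ ∀ x ∈ E ∩ Metric.ball o R, ∀ y ∈ E ∩ Metric.ball o R,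
        x ≠ y → Φ (c / 2 * ‖u x - u y‖ / ‖x - y‖) ≤ M * Ψ / ‖x - y‖ ^ n := by
  obtain ⟨M, hM, hmorrey⟩ := exists_morrey_const hΦ
  refine ⟨M, hM, fun Ω u D h c hc o R hR hRΩ Ψ hΨ0 hΨ => ?_⟩
  set K := Metric.closedBall o (1.5 * R) with hKdef
  have hK : IsCompact K := isCompact_closedBall _ _
  have hKball : K ⊆ Metric.ball o (2 * R) :=
    Metric.closedBall_subset_ball (by linarith)
  have hKΩ : K ⊆ Ω := hKball.trans hRΩ
  have hrpos : ∀ k : ℕ, 0 < R / 20 / (k + 1) := fun k => by positivity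
  -- radii at most `R / 20`, so that mollification on the ball of radius `1.42 R` only involves `K`
  set ρ : ℕ → ContDiffBump (0 : Eucl n) := fun k =>
    ⟨R / 20 / (k + 1) / 2, R / 20 / (k + 1), by have := hrpos k; positivity,
      by have := hrpos k; linarith⟩ with hρ
  have hρout : ∀ k, (ρ k).rOut = R / 20 / (k + 1) := fun k => rfl
  have hρle : ∀ k, (ρ k).rOut ≤ R / 20 := fun k => by
    rw [hρout]
    exact div_le_self (by positivity) (by linarith [Nat.cast_nonneg (α := ℝ) k])
  have hρlim : Tendsto (fun k => (ρ k).rOut) atTop (𝓝 0) := by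
    simp only [hρout]
    exact tendsto_const_nhds.div_atTop (tendsto_atTop_add_const_right _ _ tendsto_natCast_atTop_atTop)
  set v : ℕ → Eucl n → Eucl n := fun k =>
    (ρ k).normed volume ⋆[ContinuousLinearMap.lsmul ℝ ℝ, volume] K.indicator u with hv
  have hae : ∀ᵐ x, Tendsto (fun k => v k x) atTop (𝓝 (K.indicator u x)) :=
    ContDiffBump.ae_convolution_tendsto_right_of_locallyIntegrable (K := 2) hρlim
      (Eventually.of_forall fun k => by
        change R / 20 / (k + 1) ≤ 2 * (R / 20 / (k + 1) / 2)
        linarith)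
      (h.integrable_indicator hK hKΩ).locallyIntegrable
  refine ⟨_, hae, ?_⟩
  rintro x ⟨hxE, hx⟩ y ⟨hyE, hy⟩ hxy
  have hmem : ∀ w ∈ Metric.ball o R, w ∈ K := fun w hw =>
    Metric.closedBall_subset_closedBall (by linarith) (Metric.ball_subset_closedBall hw)
  have hxlim : Tendsto (fun k => v k x) atTop (𝓝 (u x)) := by
    have : Tendsto (fun k => v k x) atTop (𝓝 (K.indicator u x)) := hxE
    rwa [indicator_of_mem (hmem x hx)] at this
  have hylim : Tendsto (fun k => v k y) atTop (𝓝 (u y)) := by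
    have : Tendsto (fun k => v k y) atTop (𝓝 (K.indicator u y)) := hyE
    rwa [indicator_of_mem (hmem y hy)] at this
  have hlim : Tendsto (fun k => Φ (c / 2 * ‖v k x - v k y‖ / ‖x - y‖)) atTop
      (𝓝 (Φ (c / 2 * ‖u x - u y‖ / ‖x - y‖))) :=
    (hΦ.cont.tendsto _).comp (((hxlim.sub hylim).norm.const_mul _).div_const _)
  refine le_of_tendsto hlim (Eventually.of_forall fun k => ?_)
  refine hmorrey (v k) ?_ c hc x y hxy Ψ ?_
  · exact (ρ k).hasCompactSupport_normed.contDiff_convolution_left _ (ρ k).contDiff_normed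
      (h.integrable_indicator hK hKΩ).locallyIntegrable
  · refine h.setIntegral_fderiv_convolution_le hK hKΩ (ρ k) (fun z hz => ?_)
      measurableSet_closedBall hΦ hc hΨ0 ((lintegral_mono_set hKball).trans hΨ)
    have hz' := closedBall_midpoint_subset hx hy hz
    rw [Metric.mem_closedBall] at hz'
    refine Metric.closedBall_subset_closedBall' ?_
    linarith [hρle k]

end Mollification

/-! ### The Osgood estimate in space -/

section Space

variable {n : ℕ}

/-- An estimate valid on a set of full measure passes to a continuous representative. -/
lemma apply_norm_sub_le_of_continuousOn {Φ : ℝ → ℝ} (hΦ : Continuous Φ) {U E : Set (Eucl n)}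
    (hU : IsOpen U) (hE : ∀ᵐ x, x ∈ E) {u u' : Eucl n → Eucl n} {κ M : ℝ}
    (h : ∀ x ∈ E ∩ U, ∀ y ∈ E ∩ U, x ≠ y → Φ (κ * ‖u x - u y‖ / ‖x - y‖) ≤ M / ‖x - y‖ ^ n)
    (hc : ContinuousOn u' U) (heq : u' =ᵐ[volume.restrict U] u) :
    ∀ x ∈ U, ∀ y ∈ U, x ≠ y → Φ (κ * ‖u' x - u' y‖ / ‖x - y‖) ≤ M / ‖x - y‖ ^ n := by
  intro x hx y hy hxy
  set A : Set (Eucl n) := {z | z ∈ E ∧ (z ∈ U → u' z = u z)} with hA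
  have hAae : ∀ᵐ z, z ∈ A := by
    filter_upwards [hE, (ae_restrict_iff' hU.measurableSet).1 heq] with z h1 h2
    exact ⟨h1, h2⟩
  have hAd : Dense A := Measure.dense_of_ae hAae
  have hne : ∀ z ∈ U, (𝓝[A ∩ U] z).NeBot := by
    intro z hz
    rw [nhdsWithin_inter_of_mem' (mem_nhdsWithin_of_mem_nhds (hU.mem_nhds hz))]
    exact mem_closure_iff_nhdsWithin_neBot.1 (hAd z)
  have := hne x hx
  have := hne y hy
  have hlim : ∀ z ∈ U, Tendsto u' (𝓝[A ∩ U] z) (𝓝 (u' z)) := fun z hz =>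
    (hc z hz).mono_left (nhdsWithin_mono _ inter_subset_right)
  have hid : ∀ z : Eucl n, Tendsto (fun z => z) (𝓝[A ∩ U] z) (𝓝 z) := fun z =>
    tendsto_id.mono_left nhdsWithin_le_nhds
  have hxy0 : ‖x - y‖ ≠ 0 := norm_ne_zero_iff.2 (sub_ne_zero.2 hxy)
  have hd : Tendsto (fun p : Eucl n × Eucl n => ‖p.1 - p.2‖) (𝓝[A ∩ U] x ×ˢ 𝓝[A ∩ U] y)
      (𝓝 ‖x - y‖) :=
    (((hid x).comp tendsto_fst).sub ((hid y).comp tendsto_snd)).norm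
  have hl : Tendsto (fun p : Eucl n × Eucl n => Φ (κ * ‖u' p.1 - u' p.2‖ / ‖p.1 - p.2‖))
      (𝓝[A ∩ U] x ×ˢ 𝓝[A ∩ U] y) (𝓝 (Φ (κ * ‖u' x - u' y‖ / ‖x - y‖))) :=
    (hΦ.tendsto _).comp (((((hlim x hx).comp tendsto_fst).sub
      ((hlim y hy).comp tendsto_snd)).norm.const_mul κ).div hd hxy0)
  have hr : Tendsto (fun p : Eucl n × Eucl n => M / ‖p.1 - p.2‖ ^ n)
      (𝓝[A ∩ U] x ×ˢ 𝓝[A ∩ U] y) (𝓝 (M / ‖x - y‖ ^ n)) :=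
    tendsto_const_nhds.div (hd.pow n) (pow_ne_zero n hxy0)
  refine le_of_tendsto_of_tendsto hl hr ?_
  have hne' : ∀ᶠ p : Eucl n × Eucl n in 𝓝[A ∩ U] x ×ˢ 𝓝[A ∩ U] y, ‖p.1 - p.2‖ ≠ 0 :=
    hd.eventually_ne hxy0
  have hmem : ∀ᶠ p : Eucl n × Eucl n in 𝓝[A ∩ U] x ×ˢ 𝓝[A ∩ U] y,
      p.1 ∈ A ∩ U ∧ p.2 ∈ A ∩ U :=
    (eventually_mem_nhdsWithin (a := x) (s := A ∩ U)).prod_mk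
      (eventually_mem_nhdsWithin (a := y) (s := A ∩ U))
  filter_upwards [hne', hmem] with p hp ⟨h1, h2⟩
  rw [h1.1.2 h1.2, h2.1.2 h2.2]
  exact h _ ⟨h1.1.1, h1.2⟩ _ ⟨h2.1.1, h2.2⟩ (sub_ne_zero.1 (norm_ne_zero_iff.1 hp))

/-- `ω` controls the oscillation of weakly differentiable functions by their Orlicz energy `Ψ`, on
a set of full measure and for every continuous representative, with a constant affine in `Ψ`. -/
def IsOrliczModulus (n : ℕ) (Θ ω : ℝ → ℝ) : Prop :=
  ∀ c, 0 < c → ∃ A > 0,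
    ∀ (Ω : Set (Eucl n)) (u : Eucl n → Eucl n) (D : Eucl n → Eucl n →L[ℝ] Eucl n),
    HasWeakDifferential Ω u D → ∀ o R, 0 < R → Metric.ball o (2 * R) ⊆ Ω →
    ∀ Ψ : ℝ, 0 ≤ Ψ →
    ∫⁻ z in Metric.ball o (2 * R), ENNReal.ofReal (Θ (c * ‖D z‖)) ≤ ENNReal.ofReal Ψ →
    (∃ E : Set (Eucl n), (∀ᵐ x, x ∈ E) ∧ ∀ x ∈ E ∩ Metric.ball o R, ∀ y ∈ E ∩ Metric.ball o R,
      ‖u x - u y‖ ≤ A * (1 + Ψ) * ω ‖x - y‖) ∧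
    ∀ u' : Eucl n → Eucl n, ContinuousOn u' Ω → u' =ᵐ[volume.restrict Ω] u →
      ∀ x ∈ Metric.ball o R, ∀ y ∈ Metric.ball o R,
        ‖u' x - u' y‖ ≤ A * (1 + Ψ) * ω ‖x - y‖

theorem IsAdmissibleTheta.exists_isOrliczModulus (hn : 1 ≤ n) {Θ : ℝ → ℝ}
    (hΘ : IsAdmissibleTheta n Θ) : ∃ ω : ℝ → ℝ, IsOsgoodModulus ω ∧ IsOrliczModulus n Θ ω := by
  obtain ⟨q, hΦ⟩ := hΘ.exists_isGrowthFunction hn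
  obtain ⟨C, h, hh⟩ := hΘ.exists_hasQuasiInverse
  set Φ : ℝ → ℝ := fun s => Θ (max s 0) with hΦdef
  have hω := isOsgoodModulus_osgoodModulus hn hΦ hh (hΘ.lintegral_Ioi_eq_top hh.one_le)
  refine ⟨_, hω, fun c hc => ?_⟩
  obtain ⟨M, hM, hmorrey⟩ := exists_morrey_const_of_hasWeakDifferential hΦ
  obtain ⟨A, hA, hAle⟩ := exists_le_mul_osgoodModulus hΦ hh hM (half_pos hc)
  refine ⟨A, hA, fun Ω u D hu o R hR hRΩ Ψ hΨ0 hΨ => ?_⟩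
  have hΨ' : ∫⁻ z in Metric.ball o (2 * R), ENNReal.ofReal (Φ (c * ‖D z‖)) ≤
      ENNReal.ofReal Ψ := by
    refine le_trans (le_of_eq (lintegral_congr fun z => ?_)) hΨ
    simp only [hΦdef]
    rw [max_eq_left (mul_nonneg hc.le (norm_nonneg _))]
  have hconv : ∀ (v : Eucl n → Eucl n) (x y : Eucl n),
      (x ≠ y → Φ (c / 2 * ‖v x - v y‖ / ‖x - y‖) ≤ M * Ψ / ‖x - y‖ ^ n) →
      ‖v x - v y‖ ≤ A * (1 + Ψ) * osgoodModulus n Φ C h ‖x - y‖ := by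
    intro v x y hxy
    by_cases heq : x = y
    · rw [heq, sub_self, sub_self, norm_zero, hω.zero, mul_zero]
    · exact hAle Ψ hΨ0 _ (norm_pos_iff.2 (sub_ne_zero.2 heq)) _ (hxy heq)
  obtain ⟨E, hE, hest⟩ := hmorrey Ω u D hu c hc o R hR hRΩ Ψ hΨ0 hΨ'
  refine ⟨⟨E, hE, fun x hx y hy => hconv u x y fun hxy => hest x hx y hy hxy⟩,
    fun u' hu' heq x hx y hy => hconv u' x y fun hxy => ?_⟩
  have hball : Metric.ball o R ⊆ Ω :=
    (Metric.ball_subset_ball (by linarith)).trans hRΩ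
  exact apply_norm_sub_le_of_continuousOn hΦ.cont Metric.isOpen_ball hE hest
    (hu'.mono hball) (ae_mono (Measure.restrict_mono hball le_rfl) heq) x hx y hy hxy

/-- The Osgood condition forces the modulus to be continuous at the origin. -/
lemma IsOsgoodModulus.exists_lt {ω : ℝ → ℝ} (hω : IsOsgoodModulus ω) {ε : ℝ} (hε : 0 < ε) :
    ∃ δ > 0, ω δ < ε := by
  by_contra! hcon
  have h1 : ∫⁻ δ in Ioo (0 : ℝ) 1, ENNReal.ofReal (1 / ω δ) ≤
      ∫⁻ δ in Ioo (0 : ℝ) 1, ENNReal.ofReal (1 / ε) :=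
    setLIntegral_mono' measurableSet_Ioo fun δ hδ =>
      ENNReal.ofReal_le_ofReal (one_div_le_one_div_of_le hε (hcon δ hδ.1))
  rw [hω.integral_eq_top] at h1
  simp at h1

/-- A function that locally has an Osgood modulus on a set of full measure has a continuous
representative. -/
lemma IsOsgoodModulus.exists_continuousOn {ω : ℝ → ℝ} (hω : IsOsgoodModulus ω) {Ω E : Set (Eucl n)}
    (hΩ : IsOpen Ω) (hE : ∀ᵐ x, x ∈ E) {u : Eucl n → Eucl n}
    (h : ∀ x ∈ Ω, ∃ V ∈ 𝓝 x, ∃ A : ℝ, ∀ y ∈ E ∩ V, ∀ z ∈ E ∩ V, ‖u y - u z‖ ≤ A * ω ‖y - z‖) :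
    ∃ u' : Eucl n → Eucl n, ContinuousOn u' Ω ∧ u' =ᵐ[volume.restrict Ω] u := by
  have hEd : Dense E := Measure.dense_of_ae hE
  have hlim : ∀ x ∈ Ω, ∃ y, Tendsto u (𝓝[E] x) (𝓝 y) := by
    intro x hx
    obtain ⟨V, hV, A, hA⟩ := h x hx
    have : (𝓝[E] x).NeBot := mem_closure_iff_nhdsWithin_neBot.1 (hEd x)
    refine CompleteSpace.complete (Metric.cauchy_iff.2 ⟨inferInstance, fun ε hε => ?_⟩)
    obtain ⟨δ, hδ, hδω⟩ := hω.exists_lt (ε := ε / (|A| + 1)) (by positivity)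
    refine ⟨u '' (E ∩ (V ∩ Metric.ball x (δ / 2))), image_mem_map ?_, ?_⟩
    · exact inter_mem self_mem_nhdsWithin (mem_nhdsWithin_of_mem_nhds
        (inter_mem hV (Metric.ball_mem_nhds x (half_pos hδ))))
    · rintro _ ⟨y, ⟨hyE, hyV, hy⟩, rfl⟩ _ ⟨z, ⟨hzE, hzV, hz⟩, rfl⟩
      have hyz : ‖y - z‖ ≤ δ := by
        rw [← dist_eq_norm]
        rw [Metric.mem_ball] at hy hz
        have := dist_triangle_right y z x
        linarith
      have h1 : ω ‖y - z‖ ≤ ω δ := hω.monotoneOn (norm_nonneg _) hδ.le hyz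
      have h0 : 0 ≤ ω ‖y - z‖ := by
        rw [← hω.zero]
        exact hω.monotoneOn self_mem_Ici (norm_nonneg _) (norm_nonneg _)
      rw [dist_eq_norm]
      calc ‖u y - u z‖ ≤ A * ω ‖y - z‖ := hA y ⟨hyE, hyV⟩ z ⟨hzE, hzV⟩
        _ ≤ (|A| + 1) * ω ‖y - z‖ := by
            gcongr
            linarith [le_abs_self A]
        _ ≤ (|A| + 1) * ω δ := by gcongr
        _ < ε := by
            rw [lt_div_iff₀ (by positivity)] at hδω
            linarith
  refine ⟨extendFrom E u, continuousOn_extendFrom (fun x _ => hEd x) hlim, ?_⟩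
  rw [EventuallyEq, ae_restrict_iff' hΩ.measurableSet]
  filter_upwards [hE] with x hxE hx
  obtain ⟨y, hy⟩ := hlim x hx
  rw [extendFrom_eq (hEd x) hy]
  have h1 : Tendsto u (pure x) (𝓝 y) := hy.mono_left (pure_le_nhdsWithin hxE)
  exact tendsto_nhds_unique h1 (tendsto_pure_nhds u x)

end Space

/-! ### The Osgood estimate in space-time -/

section Time

variable {n : ℕ} {Θ ω : ℝ → ℝ} {I : Set ℝ} {Ω : Set (Eucl n)} {b : ℝ → Eucl n → Eucl n}
  {D : ℝ → Eucl n → Eucl n →L[ℝ] Eucl n}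

lemma MemL1locW11loc.aemeasurable_orlicz (hb : MemL1locW11loc I Ω b D)
    (hΘ : IsAdmissibleTheta n Θ) {c : ℝ} (hc : 0 < c) {B : Set (Eucl n)} (hB : B ⊆ Ω) :
    AEMeasurable (fun t => ∫⁻ z in B, ENNReal.ofReal (Θ (c * ‖D t z‖))) (volume.restrict I) := by
  have hcont : Continuous (fun s => Θ (max s 0)) :=
    hΘ.locallyLipschitzOn.continuousOn.comp_continuous (by fun_prop) fun s =>
      mem_Ici.2 (le_max_right _ _)
  have h1 : AEStronglyMeasurable (fun p : ℝ × Eucl n => D p.1 p.2)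
      (volume.restrict (I ×ˢ Ω)) := hb.locallyIntegrableOn_diff.aestronglyMeasurable
  have h2 : AEMeasurable (fun p : ℝ × Eucl n => ‖D p.1 p.2‖)
      ((volume.restrict I).prod (volume.restrict B)) := by
    rw [Measure.prod_restrict]
    exact h1.norm.aemeasurable.mono_measure
      (Measure.restrict_mono (prod_mono le_rfl hB) le_rfl)
  have h3 : AEMeasurable (fun p : ℝ × Eucl n => ENNReal.ofReal (Θ (c * ‖D p.1 p.2‖)))
      ((volume.restrict I).prod (volume.restrict B)) := by
    refine ((hcont.measurable.comp_aemeasurable (h2.const_mul c)).ennreal_ofReal).congr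
      (Eventually.of_forall fun p => ?_)
    simp only [Function.comp]
    rw [max_eq_left (mul_nonneg hc.le (norm_nonneg _))]
  exact h3.lintegral_prod_right'

/-- A property of almost every time holds on an open set if it holds on its compact subsets. -/
lemma ae_restrict_of_forall_isCompact (hI : IsOpen I) {p : ℝ → Prop}
    (h : ∀ K, IsCompact K → K ⊆ I → ∀ᵐ t ∂(volume.restrict K), p t) :
    ∀ᵐ t ∂(volume.restrict I), p t := by
  have : LocallyCompactSpace I := hI.locallyCompactSpace
  obtain ⟨F, hFc, hFI⟩ : IsSigmaCompact I :=
    isSigmaCompact_iff_sigmaCompactSpace.2 inferInstance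
  rw [← hFI, ae_restrict_iUnion_iff]
  exact fun i => h (F i) (hFc i) (hFI ▸ subset_iUnion F i)

/-- The space-time form of the modulus of continuity. The set `J` is the time interval or its
closure. -/
lemma MemL1locW11loc.exists_osgood_estimate (hb : MemL1locW11loc I Ω b D)
    (hΘ : IsAdmissibleTheta n Θ) (hω : IsOrliczModulus n Θ ω) (hI : IsOpen I) {J : Set ℝ}
    (hIJ : I ⊆ J) (hJ : volume.restrict J = volume.restrict I) {o : Eucl n} {c R : ℝ} (hc : 0 < c)
    (hR : 0 < R) (hRΩ : Metric.ball o (2 * R) ⊆ Ω) (hO : OrliczIntegrable Θ J D o c R) :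
    ∃ φ : ℝ → ℝ, (∀ t, 0 < φ t) ∧ (∀ K, IsCompact K → K ⊆ J → IntegrableOn φ K) ∧
      (∀ᵐ t ∂(volume.restrict I), ∃ E : Set (Eucl n), (∀ᵐ x, x ∈ E) ∧
        ∀ x ∈ E ∩ Metric.ball o R, ∀ y ∈ E ∩ Metric.ball o R,
          ‖b t x - b t y‖ ≤ φ t * ω ‖x - y‖) ∧
      ∀ᵐ t ∂(volume.restrict I), ∀ u' : Eucl n → Eucl n, ContinuousOn u' Ω →
        u' =ᵐ[volume.restrict Ω] b t → ∀ x ∈ Metric.ball o R, ∀ y ∈ Metric.ball o R,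
          ‖u' x - u' y‖ ≤ φ t * ω ‖x - y‖ := by
  obtain ⟨A, hA, hest⟩ := hω c hc
  set ψ : ℝ → ENNReal := fun t => ∫⁻ z in Metric.ball o (2 * R), ENNReal.ofReal (Θ (c * ‖D t z‖))
    with hψ
  have hψm : AEMeasurable ψ (volume.restrict J) := by
    rw [hJ]
    exact hb.aemeasurable_orlicz hΘ hc hRΩ
  have hψtop : ∀ᵐ t ∂(volume.restrict I), ψ t < ⊤ :=
    ae_restrict_of_forall_isCompact hI fun K hK hKI =>
      ae_lt_top' (hψm.mono_measure (Measure.restrict_mono (hKI.trans hIJ) le_rfl))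
        (hO K hK (hKI.trans hIJ)).ne
  have hslice : ∀ᵐ t ∂(volume.restrict I), HasWeakDifferential Ω (b t) (D t) ∧ ψ t < ⊤ :=
    hb.hasWeakDifferential.and hψtop
  refine ⟨fun t => A * (1 + (ψ t).toReal), fun t => ?_, fun K hK hKJ => ?_, ?_, ?_⟩
  · have := ENNReal.toReal_nonneg (a := ψ t)
    positivity
  · have hKm : AEMeasurable ψ (volume.restrict K) :=
      hψm.mono_measure (Measure.restrict_mono hKJ le_rfl)
    have h1 : IntegrableOn (fun _ : ℝ => (1 : ℝ)) K := continuousOn_const.integrableOn_compact hK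
    have h2 : IntegrableOn (fun t => (ψ t).toReal) K :=
      integrable_toReal_of_lintegral_ne_top hKm (hO K hK hKJ).ne
    exact (h1.add h2).const_mul A
  · filter_upwards [hslice] with t ⟨h1, h2⟩
    exact (hest Ω (b t) (D t) h1 o R hR hRΩ _ ENNReal.toReal_nonneg
      (ENNReal.ofReal_toReal h2.ne).ge).1
  · filter_upwards [hslice] with t ⟨h1, h2⟩
    exact (hest Ω (b t) (D t) h1 o R hR hRΩ _ ENNReal.toReal_nonneg
      (ENNReal.ofReal_toReal h2.ne).ge).2

/-- Existence of a representative that is continuous in space. -/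
lemma MemL1locW11loc.exists_isContinuousRepresentative (hb : MemL1locW11loc I Ω b D)
    (hΘ : IsAdmissibleTheta n Θ) (hω : IsOrliczModulus n Θ ω) (hωo : IsOsgoodModulus ω)
    (hI : IsOpen I) (hΩ : IsOpen Ω) (hO : LocallyOrliczIntegrable Θ I Ω D) :
    ∃ b' : ℝ → Eucl n → Eucl n, IsContinuousRepresentative I Ω b b' := by
  have hloc : ∀ o : Ω, ∃ R > 0, ∃ φ : ℝ → ℝ, ∀ᵐ t ∂(volume.restrict I),
      ∃ E : Set (Eucl n), (∀ᵐ x, x ∈ E) ∧ ∀ x ∈ E ∩ Metric.ball (o : Eucl n) R,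
        ∀ y ∈ E ∩ Metric.ball (o : Eucl n) R, ‖b t x - b t y‖ ≤ φ t * ω ‖x - y‖ := by
    rintro ⟨o, ho⟩
    obtain ⟨c, hc, R, hR, hRΩ, hOR⟩ := hO o ho
    obtain ⟨φ, -, -, h, -⟩ := hb.exists_osgood_estimate hΘ hω hI le_rfl rfl hc hR hRΩ hOR
    exact ⟨R, hR, φ, h⟩
  choose R hR φ hφ using hloc
  -- countably many of the balls cover `Ω`
  obtain ⟨T, hT, hTU⟩ := TopologicalSpace.isOpen_iUnion_countable
    (fun o : Ω => Metric.ball (o : Eucl n) (R o)) fun o => Metric.isOpen_ball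
  have hcover : ∀ x ∈ Ω, ∃ o ∈ T, x ∈ Metric.ball (o : Eucl n) (R o) := by
    intro x hx
    have : x ∈ ⋃ o : Ω, Metric.ball (o : Eucl n) (R o) :=
      mem_iUnion.2 ⟨⟨x, hx⟩, Metric.mem_ball_self (hR _)⟩
    rw [← hTU] at this
    simpa using this
  have hall : ∀ᵐ t ∂(volume.restrict I), ∀ o ∈ T,
      ∃ E : Set (Eucl n), (∀ᵐ x, x ∈ E) ∧ ∀ x ∈ E ∩ Metric.ball (o : Eucl n) (R o),
        ∀ y ∈ E ∩ Metric.ball (o : Eucl n) (R o), ‖b t x - b t y‖ ≤ φ o t * ω ‖x - y‖ :=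
    (ae_ball_iff hT).2 fun o _ => hφ o
  have hex : ∀ᵐ t ∂(volume.restrict I), ∃ u' : Eucl n → Eucl n,
      ContinuousOn u' Ω ∧ u' =ᵐ[volume.restrict Ω] b t := by
    filter_upwards [hall] with t ht
    choose! E hE hest using ht
    refine hωo.exists_continuousOn hΩ (E := ⋂ o ∈ T, E o) ?_ fun x hx => ?_
    · simp only [mem_iInter]
      exact (ae_ball_iff hT).2 fun o ho => hE o ho
    · obtain ⟨o, hoT, hxo⟩ := hcover x hx
      refine ⟨_, Metric.isOpen_ball.mem_nhds hxo, φ o t, fun y hy z hz => ?_⟩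
      exact hest o hoT y ⟨mem_iInter₂.1 hy.1 o hoT, hy.2⟩ z ⟨mem_iInter₂.1 hz.1 o hoT, hz.2⟩
  classical
  refine ⟨fun t => if h : ∃ u' : Eucl n → Eucl n,
      ContinuousOn u' Ω ∧ u' =ᵐ[volume.restrict Ω] b t then h.choose else 0, ?_⟩
  filter_upwards [hex] with t ht
  rw [dif_pos ht]
  exact ht.choose_spec

/-- At a fixed point, a continuous representative is measurable in time, as a limit of means. -/
lemma MemL1locW11loc.aestronglyMeasurable_apply (hb : MemL1locW11loc I Ω b D) (hΩ : IsOpen Ω)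
    {b' : ℝ → Eucl n → Eucl n} (hb' : IsContinuousRepresentative I Ω b b') {x : Eucl n}
    (hx : x ∈ Ω) : AEStronglyMeasurable (fun t => b' t x) (volume.restrict I) := by
  obtain ⟨r, hr, hrΩ⟩ := Metric.nhds_basis_closedBall.mem_iff.1 (hΩ.mem_nhds hx)
  have hρ : ∀ k : ℕ, 0 < r / (k + 1) := fun k => by positivity
  set B : ℕ → Set (Eucl n) := fun k => Metric.closedBall x (r / (k + 1)) with hB
  have hBc : ∀ k, IsCompact (B k) := fun k => isCompact_closedBall _ _
  have hBΩ : ∀ k, B k ⊆ Ω := fun k => (Metric.closedBall_subset_closedBall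
    (div_le_self hr.le (by linarith [Nat.cast_nonneg (α := ℝ) k]))).trans hrΩ
  have hmeas : ∀ k, AEStronglyMeasurable (fun t => ⨍ y in B k, b t y) (volume.restrict I) := by
    intro k
    simp only [setAverage_eq]
    have h1 : AEStronglyMeasurable (fun p : ℝ × Eucl n => b p.1 p.2)
        ((volume.restrict I).prod (volume.restrict (B k))) := by
      rw [Measure.prod_restrict]
      exact hb.locallyIntegrableOn.aestronglyMeasurable.mono_measure
        (Measure.restrict_mono (prod_mono le_rfl (hBΩ k)) le_rfl)
    exact h1.integral_prod_right'.const_smul (volume.real (B k))⁻¹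
  refine aestronglyMeasurable_of_tendsto_ae atTop hmeas ?_
  filter_upwards [hb'] with t ⟨hc, heq⟩
  rw [Metric.tendsto_atTop]
  intro ε hε
  obtain ⟨δ, hδ, hδε⟩ := Metric.continuousAt_iff.1 (hc.continuousAt (hΩ.mem_nhds hx)) (ε / 2)
    (half_pos hε)
  have hlim : Tendsto (fun k : ℕ => r / ((k : ℝ) + 1)) atTop (𝓝 0) :=
    tendsto_const_nhds.div_atTop (tendsto_atTop_add_const_right _ _ tendsto_natCast_atTop_atTop)
  obtain ⟨N, hN⟩ := eventually_atTop.1 (hlim.eventually (gt_mem_nhds hδ))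
  refine ⟨N, fun k hk => ?_⟩
  have heqB : b' t =ᵐ[volume.restrict (B k)] b t :=
    ae_mono (Measure.restrict_mono (hBΩ k) le_rfl) heq
  have havg : ⨍ y in B k, b t y = ⨍ y in B k, b' t y := by
    rw [setAverage_eq, setAverage_eq, integral_congr_ae heqB]
  have hmem : ⨍ y in B k, b' t y ∈ Metric.closedBall (b' t x) (ε / 2) := by
    refine (convex_closedBall _ _).set_average_mem Metric.isClosed_closedBall
      (Metric.measure_closedBall_pos volume x (hρ k)).ne' (hBc k).measure_lt_top.ne ?_
      ((hc.mono (hBΩ k)).integrableOn_compact (hBc k))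
    refine (ae_restrict_iff' (hBc k).measurableSet).2 (Eventually.of_forall fun y hy => ?_)
    exact (hδε ((Metric.mem_closedBall.1 hy).trans_lt (hN k hk))).le
  rw [havg]
  exact (Metric.mem_closedBall.1 hmem).trans_lt (half_lt_self hε)

/-- A continuous representative is locally bounded in space by a locally integrable function of
time: compare with its mean over a ball. -/
lemma MemL1locW11loc.exists_norm_le (hb : MemL1locW11loc I Ω b D)
    (hωo : IsOsgoodModulus ω) {b' : ℝ → Eucl n → Eucl n}
    (hb' : IsContinuousRepresentative I Ω b b') {o : Eucl n} {R : ℝ} (hR : 0 < R)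
    (hRΩ : Metric.ball o R ⊆ Ω) {φ : ℝ → ℝ} (hφ0 : ∀ t, 0 < φ t)
    (hφi : ∀ K, IsCompact K → K ⊆ I → IntegrableOn φ K)
    (hφ : ∀ᵐ t ∂(volume.restrict I), ∀ x ∈ Metric.ball o R, ∀ y ∈ Metric.ball o R,
      ‖b' t x - b' t y‖ ≤ φ t * ω ‖x - y‖) :
    ∃ m : ℝ → ℝ, (∀ K, IsCompact K → K ⊆ I → IntegrableOn m K) ∧
      ∀ᵐ t ∂(volume.restrict I), ∀ x ∈ Metric.ball o R, ‖b' t x‖ ≤ m t := by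
  set B := Metric.closedBall o (R / 2) with hB
  have hBc : IsCompact B := isCompact_closedBall _ _
  have hBR : B ⊆ Metric.ball o R := Metric.closedBall_subset_ball (by linarith)
  set V := volume.real B with hV
  have hVpos : 0 < V := ENNReal.toReal_pos
    (Metric.measure_closedBall_pos volume o (half_pos hR)).ne' hBc.measure_lt_top.ne
  refine ⟨fun t => φ t * ω (2 * R) + V⁻¹ * ∫ y in B, ‖b t y‖, fun K hK hKI => ?_, ?_⟩
  · have h1 : IntegrableOn (fun p : ℝ × Eucl n => b p.1 p.2) (K ×ˢ B) :=
      hb.locallyIntegrableOn.integrableOn_compact_subset (prod_mono hKI (hBR.trans hRΩ))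
        (hK.prod hBc)
    have h2 : Integrable (fun p : ℝ × Eucl n => ‖b p.1 p.2‖)
        ((volume.restrict K).prod (volume.restrict B)) := by
      rw [Measure.prod_restrict]
      exact h1.norm
    exact ((hφi K hK hKI).mul_const _).add (h2.integral_prod_left.const_mul _)
  · filter_upwards [hb', hφ] with t ⟨hc, heq⟩ hest x hx
    have heqB : b' t =ᵐ[volume.restrict B] b t :=
      ae_mono (Measure.restrict_mono (hBR.trans hRΩ) le_rfl) heq
    have heqint : ∫ y in B, ‖b' t y‖ = ∫ y in B, ‖b t y‖ :=
      integral_congr_ae (heqB.fun_comp (‖·‖))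
    have hint : IntegrableOn (fun y => ‖b' t y‖) B :=
      (hc.mono (hBR.trans hRΩ)).norm.integrableOn_compact hBc
    have hconst : ∀ a : ℝ, IntegrableOn (fun _ : Eucl n => a) B := fun a =>
      continuousOn_const.integrableOn_compact hBc
    have hle : ∫ _ in B, ‖b' t x‖ ≤ ∫ y in B, (φ t * ω (2 * R) + ‖b' t y‖) := by
      refine setIntegral_mono_on (hconst _) ((hconst _).add hint) hBc.measurableSet fun y hy => ?_
      have h1 := hest x hx y (hBR hy)
      have hxy : ‖x - y‖ ≤ 2 * R := by
        have h2 := dist_triangle_right x y o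
        rw [← dist_eq_norm]
        linarith [Metric.mem_ball.1 hx, Metric.mem_ball.1 (hBR hy)]
      have h2 : ω ‖x - y‖ ≤ ω (2 * R) :=
        hωo.monotoneOn (norm_nonneg _) (mem_Ici.2 (by linarith)) hxy
      have h3 := norm_le_norm_sub_add (b' t x) (b' t y)
      have h4 := mul_le_mul_of_nonneg_left h2 (hφ0 t).le
      linarith
    rw [setIntegral_const, integral_add (hconst _) hint, setIntegral_const, ← hV, smul_eq_mul,
      smul_eq_mul, heqint] at hle
    rw [← le_div_iff₀' hVpos] at hle
    refine hle.trans_eq ?_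
    field_simp

end Time

/-! ### Existence of solutions under Carathéodory conditions -/

section Caratheodory

/-- Carathéodory conditions on `f` over the times `J` and the states `X`: measurable in time,
continuous in space, and dominated by an integrable function of time. -/
structure IsCaratheodoryOn {E : Type*} [NormedAddCommGroup E] (J : Set ℝ) (X : Set E)
    (f : ℝ → E → E) (m : ℝ → ℝ) : Prop where
  measurableSet : MeasurableSet J
  aestronglyMeasurable : ∀ y ∈ X, AEStronglyMeasurable (fun t => f t y) (volume.restrict J)
  continuousOn : ∀ᵐ t ∂(volume.restrict J), ContinuousOn (f t) X
  integrableOn : IntegrableOn m J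
  norm_le : ∀ᵐ t ∂(volume.restrict J), ∀ y ∈ X, ‖f t y‖ ≤ m t

/-- The Picard operator: the primitive of `f` along the curve `γ`, over the times in `J`. -/
noncomputable def picardMap {E : Type*} [NormedAddCommGroup E] [NormedSpace ℝ E] (J : Set ℝ)
    (f : ℝ → E → E) (s : ℝ) (x : E) (γ : ℝ → E) (t : ℝ) : E :=
  x + ∫ τ in s..t, J.indicator (fun τ => f τ (γ τ)) τ

/-- A continuous time shift towards `s` by `δ`, which is constant within distance `δ` of `s`. -/
noncomputable def delay (s δ τ : ℝ) : ℝ := s + max (τ - s - δ) 0 + min (τ - s + δ) 0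

lemma continuous_delay (s δ : ℝ) : Continuous (delay s δ) := by
  unfold delay
  fun_prop

lemma abs_delay_sub_le {s δ : ℝ} (hδ : 0 < δ) (τ : ℝ) : |delay s δ τ - τ| ≤ δ := by
  unfold delay
  rw [abs_le]
  rcases max_cases (τ - s - δ) 0 with h | h <;> rcases min_cases (τ - s + δ) 0 with h' | h' <;>
    constructor <;> linarith [h.1, h.2, h'.1, h'.2]

lemma abs_delay_sub_left_le {s δ ρ τ : ℝ} (hρ : 0 ≤ ρ) (hτ : |τ - s| ≤ ρ + δ) :
    |delay s δ τ - s| ≤ ρ := by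
  unfold delay
  rw [abs_le] at hτ ⊢
  rcases max_cases (τ - s - δ) 0 with h | h <;> rcases min_cases (τ - s + δ) 0 with h' | h' <;>
    constructor <;> linarith [h.1, h.2, h'.1, h'.2, hτ.1, hτ.2]

lemma abs_sub_floor_div_le (t : ℝ) (k : ℕ) :
    dist ((⌊((k : ℝ) + 1) * t⌋ : ℝ) / ((k : ℝ) + 1)) t ≤ 1 / ((k : ℝ) + 1) := by
  have hk : (0 : ℝ) < (k : ℝ) + 1 := by positivity
  rw [Real.dist_eq, div_sub' hk.ne', abs_div, abs_of_pos hk]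
  refine div_le_div_of_nonneg_right ?_ hk.le
  rw [abs_le]
  constructor <;> linarith [Int.floor_le (((k : ℝ) + 1) * t), Int.lt_floor_add_one (((k : ℝ) + 1) * t)]

variable {E : Type*} [NormedAddCommGroup E] {J : Set ℝ} {X : Set E} {f : ℝ → E → E} {m : ℝ → ℝ}

/-- Superposition with a continuous curve is measurable: approximate the curve by step functions. -/
lemma IsCaratheodoryOn.aestronglyMeasurable_comp (h : IsCaratheodoryOn J X f m) {γ : ℝ → E}
    (hγ : Continuous γ) (hγX : ∀ t, γ t ∈ X) :
    AEStronglyMeasurable (fun t => f t (γ t)) (volume.restrict J) := by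
  set p : ℕ → ℝ → ℝ := fun k t => (⌊((k : ℝ) + 1) * t⌋ : ℝ) / ((k : ℝ) + 1) with hp
  have hlim : ∀ t, Tendsto (fun k => p k t) atTop (𝓝 t) := fun t =>
    tendsto_iff_dist_tendsto_zero.2 (squeeze_zero (fun _ => dist_nonneg)
      (abs_sub_floor_div_le t) tendsto_one_div_add_atTop_nhds_zero_nat)
  refine aestronglyMeasurable_of_tendsto_ae atTop (f := fun k t => f t (γ (p k t))) ?_ ?_
  · intro k
    set S : ℤ → Set ℝ := fun j => {t | ⌊((k : ℝ) + 1) * t⌋ = j} with hS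
    have hSm : ∀ j, MeasurableSet (S j) := fun j =>
      (Int.measurable_floor.comp (measurable_const_mul ((k : ℝ) + 1))) (measurableSet_singleton j)
    have hU : (⋃ j, S j) = univ := by
      ext t
      simp [hS]
    rw [← Measure.restrict_univ (μ := volume.restrict J), ← hU, aestronglyMeasurable_iUnion_iff]
    intro j
    refine ((h.aestronglyMeasurable (γ ((j : ℝ) / ((k : ℝ) + 1))) (hγX _)).restrict (s := S j)).congr
      ?_
    refine (ae_restrict_iff' (hSm j)).2 (Eventually.of_forall fun t ht => ?_)
    have ht' : ⌊((k : ℝ) + 1) * t⌋ = j := ht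
    simp only [hp, ht']
  · filter_upwards [h.continuousOn] with t ht
    refine (ht (γ t) (hγX t)).tendsto.comp (tendsto_nhdsWithin_iff.2 ⟨?_, ?_⟩)
    · exact (hγ.tendsto t).comp (hlim t)
    · exact Eventually.of_forall fun k => hγX _

lemma IsCaratheodoryOn.norm_indicator_le (h : IsCaratheodoryOn J X f m) {γ : ℝ → E}
    (hγX : ∀ t, γ t ∈ X) :
    ∀ᵐ t, ‖J.indicator (fun t => f t (γ t)) t‖ ≤ J.indicator m t := by
  filter_upwards [(ae_restrict_iff' h.measurableSet).1 h.norm_le] with t ht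
  by_cases htJ : t ∈ J
  · simpa [htJ] using ht htJ _ (hγX t)
  · simp [htJ]

lemma IsCaratheodoryOn.integrable_indicator_bound (h : IsCaratheodoryOn J X f m) :
    Integrable (J.indicator m) :=
  h.integrableOn.integrable_indicator h.measurableSet

lemma IsCaratheodoryOn.integrable_indicator (h : IsCaratheodoryOn J X f m) {γ : ℝ → E}
    (hγ : Continuous γ) (hγX : ∀ t, γ t ∈ X) : Integrable (J.indicator fun t => f t (γ t)) :=
  h.integrable_indicator_bound.mono'
    ((aestronglyMeasurable_indicator_iff h.measurableSet).2 (h.aestronglyMeasurable_comp hγ hγX))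
    (h.norm_indicator_le hγX)

lemma IsCaratheodoryOn.continuous_bound (h : IsCaratheodoryOn J X f m) (s : ℝ) :
    Continuous fun t => ∫ τ in s..t, J.indicator m τ :=
  intervalIntegral.continuous_primitive
    (fun _ _ => h.integrable_indicator_bound.intervalIntegrable) s

lemma continuous_of_dist_le {g : ℝ → E} {M : ℝ → ℝ} (hM : Continuous M)
    (h : ∀ t t', dist (g t) (g t') ≤ dist (M t) (M t')) : Continuous g := by
  rw [continuous_iff_continuousAt]
  intro t
  refine tendsto_iff_dist_tendsto_zero.2 (squeeze_zero (fun _ => dist_nonneg) (fun t' => h t' t) ?_)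
  exact tendsto_iff_dist_tendsto_zero.1 (hM.tendsto t)

variable [NormedSpace ℝ E]

lemma IsCaratheodoryOn.dist_picardMap_le (h : IsCaratheodoryOn J X f m) {γ : ℝ → E}
    (hγ : Continuous γ) (hγX : ∀ t, γ t ∈ X) (s : ℝ) (x : E) (t t' : ℝ) :
    dist (picardMap J f s x γ t) (picardMap J f s x γ t') ≤
      dist (∫ τ in s..t, J.indicator m τ) (∫ τ in s..t', J.indicator m τ) := by
  have hi := h.integrable_indicator hγ hγX
  have hm := h.integrable_indicator_bound
  rw [picardMap, picardMap, dist_add_left, dist_eq_norm, dist_eq_norm,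
    intervalIntegral.integral_interval_sub_left hi.intervalIntegrable hi.intervalIntegrable,
    intervalIntegral.integral_interval_sub_left hm.intervalIntegrable hm.intervalIntegrable]
  exact intervalIntegral.norm_integral_le_abs_of_norm_le
    (ae_restrict_of_ae (h.norm_indicator_le hγX)) hm.intervalIntegrable

/-- The Picard operator takes values in a ball whose radius is the integral of the bound. -/
lemma IsCaratheodoryOn.dist_picardMap_left_le (h : IsCaratheodoryOn J X f m) {γ : ℝ → E}
    (hγX : ∀ t, γ t ∈ X) (s : ℝ) (x : E) (t : ℝ) :
    dist (picardMap J f s x γ t) x ≤ ∫ τ in J, m τ := by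
  have hm := h.integrable_indicator_bound
  have h0 : 0 ≤ᵐ[volume] J.indicator m :=
    (h.norm_indicator_le hγX).mono fun t ht => (norm_nonneg _).trans ht
  rw [picardMap, dist_self_add_left, ← integral_indicator h.measurableSet]
  refine (intervalIntegral.norm_integral_le_abs_of_norm_le
    (ae_restrict_of_ae (h.norm_indicator_le hγX)) hm.intervalIntegrable).trans ?_
  rw [intervalIntegral.abs_integral_eq_abs_integral_uIoc, abs_of_nonneg
    (integral_nonneg_of_ae (ae_restrict_of_ae h0))]
  exact setIntegral_le_integral hm h0

/-- Solutions of the equation with delay `δ`: iterating the delayed Picard operator stabilizes on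
larger and larger intervals around `s`. -/
lemma IsCaratheodoryOn.exists_delayed_solution (h : IsCaratheodoryOn J X f m) {s : ℝ} {x : E}
    (hX : Metric.closedBall x (∫ τ in J, m τ) ⊆ X) (hxX : x ∈ X) {δ : ℝ} (hδ : 0 < δ) (ε : ℝ) :
    ∃ γ : ℝ → E, (∀ t, γ t ∈ X) ∧
      (∀ t t', dist (γ t) (γ t') ≤
        dist (∫ τ in s..t, J.indicator m τ) (∫ τ in s..t', J.indicator m τ)) ∧
      ∀ t, |t - s| ≤ ε → γ t = picardMap J f s x (γ ∘ delay s δ) t := by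
  set T : (ℝ → E) → ℝ → E := fun γ => picardMap J f s x (γ ∘ delay s δ) with hT
  set g : ℕ → ℝ → E := fun N => T^[N] fun _ => x with hg
  have hgsucc : ∀ N, g (N + 1) = T (g N) := fun N => Function.iterate_succ_apply' T N _
  have hgood : ∀ N, (∀ t, g N t ∈ X) ∧ ∀ t t', dist (g N t) (g N t') ≤
      dist (∫ τ in s..t, J.indicator m τ) (∫ τ in s..t', J.indicator m τ) := by
    intro N
    induction N with
    | zero => exact ⟨fun t => hxX, fun t t' => by simp [hg]⟩
    | succ N ih =>
      have hc : Continuous (g N ∘ delay s δ) :=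
        (continuous_of_dist_le (h.continuous_bound s) ih.2).comp (continuous_delay s δ)
      have hm : ∀ t, (g N ∘ delay s δ) t ∈ X := fun t => ih.1 _
      rw [hgsucc]
      exact ⟨fun t => hX (h.dist_picardMap_left_le hm s x t), h.dist_picardMap_le hc hm s x⟩
  have hstab : ∀ N : ℕ, ∀ t, |t - s| ≤ N * δ → g (N + 1) t = g N t := by
    intro N
    induction N with
    | zero =>
      intro t ht
      have hts : t = s := by
        rw [Nat.cast_zero, zero_mul] at ht
        linarith [abs_nonpos_iff.1 ht]
      rw [hgsucc, hts]
      simp [hT, picardMap, hg]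
    | succ N ih =>
      intro t ht
      rw [hgsucc (N + 1)]
      conv_rhs => rw [hgsucc N]
      simp only [hT, picardMap]
      congr 1
      refine intervalIntegral.integral_congr fun τ hτ => ?_
      have hτs : |τ - s| ≤ N * δ + δ := by
        have h1 : |τ - s| ≤ |t - s| := abs_sub_left_of_mem_uIcc hτ
        push_cast at ht
        linarith
      have h2 := ih _ (abs_delay_sub_left_le (by positivity) hτs)
      by_cases hτJ : τ ∈ J
      · simp only [indicator_of_mem hτJ, Function.comp, h2]
      · simp [hτJ]
  obtain ⟨N, hN⟩ := exists_nat_ge (ε / δ)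
  refine ⟨g N, (hgood N).1, (hgood N).2, fun t ht => ?_⟩
  have h1 := hstab N t (ht.trans ((div_le_iff₀ hδ).1 hN))
  rw [← h1, hgsucc]

/-- Carathéodory's existence theorem in integral form: the delayed solutions converge along a
subsequence, by the Arzelà–Ascoli theorem. -/
lemma IsCaratheodoryOn.exists_eq_picardMap (h : IsCaratheodoryOn J X f m) (hXc : IsCompact X)
    {s : ℝ} {x : E} (hX : Metric.closedBall x (∫ τ in J, m τ) ⊆ X) (hxX : x ∈ X) {ε : ℝ}
    (hε : 0 < ε) :
    ∃ γ : ℝ → E, Continuous γ ∧ (∀ t, γ t ∈ X) ∧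
      ∀ t ∈ Icc (s - ε) (s + ε), γ t = picardMap J f s x γ t := by
  set M : ℝ → ℝ := fun t => ∫ τ in s..t, J.indicator m τ with hM
  have hMc : Continuous M := h.continuous_bound s
  set δ : ℕ → ℝ := fun k => 1 / ((k : ℝ) + 1) with hδ
  have hδ0 : ∀ k, 0 < δ k := fun k => by positivity
  have hδlim : Tendsto δ atTop (𝓝 0) := tendsto_one_div_add_atTop_nhds_zero_nat
  choose g hgX hgM hgeq using fun k => h.exists_delayed_solution (s := s) hX hxX (hδ0 k) ε
  have hgc : ∀ k, Continuous (g k) := fun k => continuous_of_dist_le hMc (hgM k)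
  have hle : s - ε ≤ s + ε := by linarith
  set G : ℕ → BoundedContinuousFunction (Icc (s - ε) (s + ε)) E := fun k =>
    BoundedContinuousFunction.mkOfCompact ⟨fun t => g k t, (hgc k).comp continuous_subtype_val⟩
    with hG
  have hcomp : IsCompact (closure (range G)) := by
    refine BoundedContinuousFunction.arzela_ascoli X hXc _ ?_ ?_
    · rintro _ t ⟨k, rfl⟩
      exact hgX k t
    · intro t₀
      rw [Metric.equicontinuousAt_iff]
      intro η hη
      obtain ⟨ρ, hρ, hρη⟩ := Metric.continuousAt_iff.1 (hMc.continuousAt (x := (t₀ : ℝ))) η hη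
      refine ⟨ρ, hρ, ?_⟩
      rintro t ht ⟨_, k, rfl⟩
      refine (hgM k t₀ t).trans_lt ?_
      rw [dist_comm]
      exact hρη ht
  obtain ⟨Γ, -, κ, hκ, hlim⟩ := hcomp.tendsto_subseq fun k => subset_closure (mem_range_self k)
  set γ : ℝ → E := fun t => Γ (projIcc (s - ε) (s + ε) hle t) with hγ
  have hγc : Continuous γ := Γ.continuous.comp continuous_projIcc
  have hpt : ∀ t : Icc (s - ε) (s + ε), Tendsto (fun j => g (κ j) t) atTop (𝓝 (Γ t)) := fun t =>
    (BoundedContinuousFunction.tendsto_iff_tendstoUniformly.1 hlim).tendsto_at t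
  have hγX : ∀ t, γ t ∈ X := fun t =>
    hXc.isClosed.mem_of_tendsto (hpt _) (Eventually.of_forall fun j => hgX _ _)
  have hpt' : ∀ t ∈ Icc (s - ε) (s + ε), Tendsto (fun j => g (κ j) t) atTop (𝓝 (γ t)) := by
    intro t ht
    have := hpt ⟨t, ht⟩
    simp only [hγ]
    rwa [projIcc_of_mem hle ht]
  have hδκ : Tendsto (fun j => δ (κ j)) atTop (𝓝 0) := hδlim.comp hκ.tendsto_atTop
  have hdelay : ∀ t ∈ Icc (s - ε) (s + ε),
      Tendsto (fun j => g (κ j) (delay s (δ (κ j)) t)) atTop (𝓝 (γ t)) := by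
    intro t ht
    refine tendsto_of_tendsto_of_dist (hpt' t ht) ?_
    have h1 : Tendsto (fun j => delay s (δ (κ j)) t) atTop (𝓝 t) :=
      tendsto_iff_dist_tendsto_zero.2 (squeeze_zero (fun _ => dist_nonneg)
        (fun j => abs_delay_sub_le (hδ0 _) t) hδκ)
    refine squeeze_zero (fun _ => dist_nonneg) (fun j => hgM (κ j) _ _) ?_
    simp only [dist_comm (∫ τ in s..t, J.indicator m τ)]
    exact tendsto_iff_dist_tendsto_zero.1 ((hMc.tendsto t).comp h1)
  refine ⟨γ, hγc, hγX, fun t ht => tendsto_nhds_unique (hpt' t ht) ?_⟩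
  have hs : s ∈ Icc (s - ε) (s + ε) := ⟨by linarith, by linarith⟩
  have hsub : uIoc s t ⊆ Icc (s - ε) (s + ε) := uIoc_subset_uIcc.trans
    (uIcc_subset_Icc hs ht)
  have hcγ : ∀ j, Continuous (g (κ j) ∘ delay s (δ (κ j))) := fun j =>
    (hgc _).comp (continuous_delay s _)
  have hconv : Tendsto (fun j => picardMap J f s x (g (κ j) ∘ delay s (δ (κ j))) t) atTop
      (𝓝 (picardMap J f s x γ t)) := by
    refine tendsto_const_nhds.add ?_
    refine intervalIntegral.tendsto_integral_filter_of_dominated_convergence (J.indicator m)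
      (Eventually.of_forall fun j => ?_) (Eventually.of_forall fun j => ?_)
      h.integrable_indicator_bound.intervalIntegrable ?_
    · exact (h.integrable_indicator (hcγ j) fun _ => hgX _ _).aestronglyMeasurable.restrict
    · exact (h.norm_indicator_le (γ := g (κ j) ∘ delay s (δ (κ j))) fun _ => hgX _ _).mono
        fun τ hτ _ => hτ
    · filter_upwards [(ae_restrict_iff' h.measurableSet).1 h.continuousOn] with τ hτ hτt
      by_cases hτJ : τ ∈ J
      · simp only [indicator_of_mem hτJ]
        exact (hτ hτJ (γ τ) (hγX τ)).tendsto.comp (tendsto_nhdsWithin_iff.2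
          ⟨hdelay τ (hsub hτt), Eventually.of_forall fun j => hgX _ _⟩)
      · simp only [indicator_of_notMem hτJ]
        exact tendsto_const_nhds
  refine hconv.congr fun j => (hgeq (κ j) t ?_).symm
  rw [abs_le]
  constructor <;> linarith [ht.1, ht.2]

/-- A function whose increments are dominated by those of an absolutely continuous function is
absolutely continuous. -/
lemma AbsolutelyContinuousOnInterval.of_dist_le {Y Z : Type*} [PseudoMetricSpace Y]
    [PseudoMetricSpace Z] {g : ℝ → Y} {M : ℝ → Z} {a b K : ℝ}
    (hM : AbsolutelyContinuousOnInterval M a b)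
    (h : ∀ t t', dist (g t) (g t') ≤ K * dist (M t) (M t')) :
    AbsolutelyContinuousOnInterval g a b := by
  have h0 := Tendsto.const_mul K hM
  rw [mul_zero] at h0
  refine squeeze_zero (fun _ => Finset.sum_nonneg fun _ _ => dist_nonneg) (fun p => ?_) h0
  rw [Finset.mul_sum]
  exact Finset.sum_le_sum fun i _ => h _ _

/-- Carathéodory's existence theorem. The times outside of `I` contribute nothing, so that initial
times at an endpoint of `I` are included. -/
theorem IsCaratheodoryOn.exists_isSolutionNear {n : ℕ} {I : Set ℝ} {Ω X : Set (Eucl n)}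
    {f : ℝ → Eucl n → Eucl n} {m : ℝ → ℝ} {s ε : ℝ} {x : Eucl n}
    (h : IsCaratheodoryOn (I ∩ Ioo (s - ε) (s + ε)) X f m) (hXc : IsCompact X) (hXΩ : X ⊆ Ω)
    (hX : Metric.closedBall x (∫ τ in I ∩ Ioo (s - ε) (s + ε), m τ) ⊆ X) (hxX : x ∈ X)
    (hε : 0 < ε) : ∃ γ, IsSolutionNear I Ω f s x ε γ := by
  set J := I ∩ Ioo (s - ε) (s + ε) with hJ
  obtain ⟨γ, hγc, hγX, hγ⟩ := h.exists_eq_picardMap hXc hX hxX hε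
  have hle : s - ε ≤ s + ε := by linarith
  have hs : s ∈ uIcc (s - ε) (s + ε) := by
    rw [uIcc_of_le hle]
    constructor <;> linarith
  have hi := h.integrable_indicator hγc hγX
  refine ⟨picardMap J f s x γ, ⟨?_, ?_, ?_, by simp [picardMap]⟩⟩
  · refine AbsolutelyContinuousOnInterval.of_dist_le (K := 1)
      (h.integrable_indicator_bound.intervalIntegrable.absolutelyContinuousOnInterval_intervalIntegral
        hs) fun t t' => ?_
    rw [one_mul]
    exact h.dist_picardMap_le hγc hγX s x t t'
  · intro t ht
    rw [← hγ t (Ioo_subset_Icc_self ht.2)]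
    exact hXΩ (hγX t)
  · refine (ae_restrict_iff' h.measurableSet).2 ?_
    filter_upwards [(hi.intervalIntegrable (a := s - ε) (b := s + ε)).ae_hasDerivAt_integral]
      with t ht htJ
    have htI : t ∈ Icc (s - ε) (s + ε) := Ioo_subset_Icc_self htJ.2
    have hder := ht (by rwa [uIcc_of_le hle]) s hs
    rw [indicator_of_mem htJ, hγ t htI] at hder
    exact hder.const_add x

end Caratheodory

/-! ### Uniqueness of solutions under an Osgood condition -/

section Osgood

variable {ω Φ d : ℝ → ℝ} {a b : ℝ}

/-- A continuous function that vanishes at `a` takes each value `r ∈ (0, d b]` a first time. -/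
lemma exists_first_time (hd : ContinuousOn d (Icc a b)) (ha : d a = 0) (hab : a ≤ b) {r : ℝ}
    (hr : 0 < r) (hrb : r ≤ d b) :
    ∃ t ∈ Icc a b, d t = r ∧ (∀ t' ∈ Icc a b, r ≤ d t' → t ≤ t') ∧ ∀ t' ∈ Icc a t, d t' ≤ r := by
  set S : Set ℝ := Icc a b ∩ d ⁻¹' Ici r with hS
  have hSc : IsClosed S := hd.preimage_isClosed_of_isClosed isClosed_Icc isClosed_Ici
  have hbS : b ∈ S := ⟨right_mem_Icc.2 hab, hrb⟩
  have hSb : BddBelow S := ⟨a, fun t ht => ht.1.1⟩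
  have hmem : sInf S ∈ S := hSc.csInf_mem ⟨b, hbS⟩ hSb
  have hfirst : ∀ t' ∈ Icc a b, r ≤ d t' → sInf S ≤ t' := fun t' ht' h => csInf_le hSb ⟨ht', h⟩
  have heq : d (sInf S) = r := by
    obtain ⟨t, ht, htr⟩ := intermediate_value_Icc hmem.1.1
      (hd.mono (Icc_subset_Icc_right hmem.1.2)) ⟨ha.le.trans hr.le, hmem.2⟩
    have : sInf S ≤ t := hfirst t ⟨ht.1, ht.2.trans hmem.1.2⟩ htr.ge
    rwa [le_antisymm this ht.2]
  refine ⟨sInf S, hmem.1, heq, hfirst, fun t' ht' => ?_⟩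
  by_contra! h
  have := hfirst t' ⟨ht'.1, ht'.2.trans hmem.1.2⟩ h.le
  rw [le_antisymm ht'.2 this, heq] at h
  exact lt_irrefl _ h

/-- Osgood's lemma. While `d` doubles from `r / 2` to `r`, the function `Φ` grows by at least
`(r / 2) / ω r`; summing over dyadic `r` bounds the integral of `1 / ω` by the growth of `Φ`. -/
lemma IsOsgoodModulus.nonpos_of_sub_le (hω : IsOsgoodModulus ω) (hΦ : MonotoneOn Φ (Icc a b))
    (hd : ContinuousOn d (Icc a b)) (ha : d a = 0) (hab : a ≤ b)
    (h : ∀ t' ∈ Icc a b, ∀ t ∈ Icc t' b, ∀ L, (∀ τ ∈ Icc t' t, d τ ≤ L) →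
      d t - d t' ≤ ω L * (Φ t - Φ t')) : d b ≤ 0 := by
  by_contra! hpos
  set r : ℕ → ℝ := fun k => d b / 2 ^ k with hr
  have hr0 : ∀ k, 0 < r k := fun k => by positivity
  have hrs : ∀ k, r (k + 1) = r k / 2 := fun k => by
    simp only [hr, pow_succ]
    field_simp
  have hrle : ∀ k, r k ≤ d b := fun k => div_le_self hpos.le (one_le_pow₀ one_le_two)
  choose t htI htr htfirst htle using fun k => exists_first_time hd ha hab (hr0 k) (hrle k)
  have htanti : ∀ k, t (k + 1) ≤ t k := fun k =>
    htfirst (k + 1) (t k) (htI k) (by rw [htr, hrs]; linarith [hr0 k])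
  have hstep : ∀ k, r (k + 1) / ω (r k) ≤ Φ (t k) - Φ (t (k + 1)) := by
    intro k
    rw [div_le_iff₀' (hω.pos _ (hr0 k))]
    have := h (t (k + 1)) (htI _) (t k) ⟨htanti k, (htI k).2⟩ (r k) fun τ hτ =>
      htle k τ ⟨(htI _).1.trans hτ.1, hτ.2⟩
    rw [htr, htr] at this
    linarith [hrs k]
  have hanti : ∀ x, 0 < x → ∀ y, x ≤ y → 1 / ω y ≤ 1 / ω x := fun x hx y hxy =>
    one_div_le_one_div_of_le (hω.pos x hx)
      (hω.monotoneOn (mem_Ici.2 hx.le) (mem_Ici.2 (hx.le.trans hxy)) hxy)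
  have hsum : ∀ k, ∫⁻ δ in Ioc (r k) (d b), ENNReal.ofReal (1 / ω δ) ≤
      ENNReal.ofReal (2 * (Φ (t 1) - Φ (t (k + 1)))) := by
    intro k
    induction k with
    | zero => simp [hr]
    | succ k ih =>
      have hle : r (k + 1) ≤ r k := by linarith [hrs k, hr0 k]
      have hmono : ∀ k, Φ (t (k + 1)) ≤ Φ (t k) := fun k => hΦ (htI _) (htI _) (htanti k)
      have hmono' : Φ (t (k + 1)) ≤ Φ (t 1) :=
        antitone_nat_of_succ_le (f := fun k => Φ (t k)) hmono (Nat.le_add_left 1 k)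
      have hnew : ∫⁻ δ in Ioc (r (k + 1)) (r k), ENNReal.ofReal (1 / ω δ) ≤
          ENNReal.ofReal (2 * (Φ (t (k + 1)) - Φ (t (k + 2)))) := by
        calc ∫⁻ δ in Ioc (r (k + 1)) (r k), ENNReal.ofReal (1 / ω δ)
            ≤ ∫⁻ _ in Ioc (r (k + 1)) (r k), ENNReal.ofReal (1 / ω (r (k + 1))) :=
              setLIntegral_mono measurable_const fun δ hδ =>
                ENNReal.ofReal_le_ofReal (hanti _ (hr0 _) _ hδ.1.le)
          _ = ENNReal.ofReal (1 / ω (r (k + 1)) * (r k - r (k + 1))) := by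
              rw [setLIntegral_const, Real.volume_Ioc,
                ENNReal.ofReal_mul (one_div_pos.2 (hω.pos _ (hr0 _))).le]
          _ ≤ _ := by
              refine ENNReal.ofReal_le_ofReal ?_
              have h1 := hstep (k + 1)
              have h2 : 1 / ω (r (k + 1)) * (r k - r (k + 1)) =
                  2 * (r (k + 2) / ω (r (k + 1))) := by
                rw [hrs (k + 1), hrs k]
                ring
              rw [h2]
              linarith
      rw [← Ioc_union_Ioc_eq_Ioc hle (hrle k)]
      refine (lintegral_union_le _ _ _).trans ((add_le_add hnew ih).trans ?_)
      rw [← ENNReal.ofReal_add (by linarith [hmono (k + 1)]) (by linarith)]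
      exact ENNReal.ofReal_le_ofReal (by simp only [add_assoc]; norm_num; linarith)
  have hlow : ∫⁻ δ in Ioc 0 (d b), ENNReal.ofReal (1 / ω δ) ≤
      ENNReal.ofReal (2 * (Φ b - Φ a)) := by
    have hU : Ioc 0 (d b) = ⋃ k, Ioc (r k) (d b) := by
      ext δ
      simp only [mem_Ioc, mem_iUnion]
      refine ⟨fun hδ => ?_, fun ⟨k, hk⟩ => ⟨(hr0 k).trans hk.1, hk.2⟩⟩
      obtain ⟨k, hk⟩ := pow_unbounded_of_one_lt (d b / δ) one_lt_two
      refine ⟨k, ?_, hδ.2⟩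
      rw [div_lt_iff₀ hδ.1] at hk
      exact (div_lt_iff₀' (by positivity)).2 hk
    have hmono : Monotone fun k => Ioc (r k) (d b) := fun i j hij =>
      Ioc_subset_Ioc_left
        (antitone_nat_of_succ_le (fun k => by linarith [hrs k, hr0 k]) hij)
    rw [hU, setLIntegral_iUnion_of_directed _ hmono.directed_le]
    refine iSup_le fun k => (hsum k).trans (ENNReal.ofReal_le_ofReal ?_)
    have h1 := hΦ (htI 1) (right_mem_Icc.2 hab) (htI 1).2
    have h2 := hΦ (left_mem_Icc.2 hab) (htI (k + 1)) (htI (k + 1)).1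
    linarith
  have hhigh : ∫⁻ δ in Ioc (d b) 1, ENNReal.ofReal (1 / ω δ) ≤
      ENNReal.ofReal (1 / ω (d b)) * volume (Ioc (d b) 1) := by
    rw [← setLIntegral_const]
    exact setLIntegral_mono measurable_const fun δ hδ =>
      ENNReal.ofReal_le_ofReal (hanti _ hpos _ hδ.1.le)
  refine absurd hω.integral_eq_top (ne_of_lt ?_)
  calc ∫⁻ δ in Ioo 0 1, ENNReal.ofReal (1 / ω δ)
      ≤ ∫⁻ δ in Ioc 0 (d b) ∪ Ioc (d b) 1, ENNReal.ofReal (1 / ω δ) := by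
        refine lintegral_mono_set fun δ hδ => ?_
        rcases le_or_gt δ (d b) with h1 | h1
        · exact Or.inl ⟨hδ.1, h1⟩
        · exact Or.inr ⟨h1, hδ.2.le⟩
    _ ≤ _ := (lintegral_union_le _ _ _).trans (add_le_add hlow hhigh)
    _ < ⊤ := ENNReal.add_lt_top.2 ⟨ENNReal.ofReal_lt_top,
        ENNReal.mul_lt_top ENNReal.ofReal_lt_top (by simp)⟩

/-- Osgood's lemma forwards and backwards in time. -/
lemma IsOsgoodModulus.nonpos_of_abs_sub_le (hω : IsOsgoodModulus ω) (hΦ : MonotoneOn Φ (Icc a b))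
    (hd : ContinuousOn d (Icc a b)) (hab : a ≤ b)
    (h : ∀ t' ∈ Icc a b, ∀ t ∈ Icc t' b, ∀ L, (∀ τ ∈ Icc t' t, d τ ≤ L) →
      |d t - d t'| ≤ ω L * (Φ t - Φ t')) : (d a = 0 → d b ≤ 0) ∧ (d b = 0 → d a ≤ 0) := by
  refine ⟨fun ha => hω.nonpos_of_sub_le hΦ hd ha hab fun t' ht' t ht L hL =>
    (le_abs_self _).trans (h t' ht' t ht L hL), fun hb => ?_⟩
  have hneg : MapsTo (fun t : ℝ => -t) (Icc (-b) (-a)) (Icc a b) := fun t ht =>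
    ⟨by linarith [ht.2], by linarith [ht.1]⟩
  have := hω.nonpos_of_sub_le (a := -b) (b := -a) (d := fun t => d (-t)) (Φ := fun t => -Φ (-t))
    (fun x hx y hy hxy => neg_le_neg (hΦ (hneg hy) (hneg hx) (neg_le_neg hxy)))
    (hd.comp continuous_neg.continuousOn hneg) (by simpa using hb) (neg_le_neg hab)
    fun t' ht' t ht L hL => by
      have := h (-t) (hneg ⟨ht'.1.trans ht.1, ht.2⟩) (-t') ⟨neg_le_neg ht.1, by linarith [ht'.1]⟩ L
        fun τ hτ => by simpa using hL (-τ) ⟨by linarith [hτ.2], by linarith [hτ.1]⟩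
      refine ((le_abs_self _).trans_eq (abs_sub_comm _ _)).trans (this.trans_eq ?_)
      ring
  simpa using this

variable {n : ℕ}

/-- The growth of the distance of two solutions: estimate the increment of the difference
`γ₁ - γ₂` in its own direction. -/
lemma abs_norm_sub_le_of_hasDerivAt {f : ℝ → Eucl n → Eucl n} {B : Set (Eucl n)} {φ : ℝ → ℝ}
    {γ₁ γ₂ : ℝ → Eucl n} (hω : IsOsgoodModulus ω) (hab : a ≤ b)
    (h₁ : AbsolutelyContinuousOnInterval γ₁ a b) (h₂ : AbsolutelyContinuousOnInterval γ₂ a b)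
    (hB₁ : ∀ t ∈ Icc a b, γ₁ t ∈ B) (hB₂ : ∀ t ∈ Icc a b, γ₂ t ∈ B)
    (hφ0 : ∀ t, 0 < φ t) (hφ : IntervalIntegrable φ volume a b)
    (hD : ∀ᵐ t ∂(volume.restrict (Icc a b)), HasDerivAt γ₁ (f t (γ₁ t)) t ∧
      HasDerivAt γ₂ (f t (γ₂ t)) t ∧ ∀ y ∈ B, ∀ z ∈ B, ‖f t y - f t z‖ ≤ φ t * ω ‖y - z‖)
    {L : ℝ} (hL : ∀ t ∈ Icc a b, ‖γ₁ t - γ₂ t‖ ≤ L) :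
    |‖γ₁ b - γ₂ b‖ - ‖γ₁ a - γ₂ a‖| ≤ ω L * ∫ t in a..b, φ t := by
  set v : Eucl n := (γ₁ b - γ₂ b) - (γ₁ a - γ₂ a) with hv
  refine (abs_norm_sub_norm_le _ _).trans ?_
  rw [← hv]
  have hL0 : 0 ≤ L := (norm_nonneg _).trans (hL a (left_mem_Icc.2 hab))
  have hω0 : 0 ≤ ω L := by
    rw [← hω.zero]
    exact hω.monotoneOn self_mem_Ici hL0 hL0
  have hint0 : 0 ≤ ∫ t in a..b, φ t :=
    intervalIntegral.integral_nonneg hab fun t _ => (hφ0 t).le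
  rcases (norm_nonneg v).eq_or_lt with hv0 | hv0
  · rw [← hv0]
    positivity
  set p : ℝ → ℝ := fun t => inner ℝ v (γ₁ t - γ₂ t) with hp
  have hpac : AbsolutelyContinuousOnInterval p a b := by
    refine AbsolutelyContinuousOnInterval.of_dist_le (K := ‖v‖) (h₁.sub h₂) fun t t' => ?_
    rw [Real.dist_eq, dist_eq_norm, hp, ← inner_sub_right]
    exact abs_real_inner_le_norm _ _
  have hpv : p b - p a = ‖v‖ * ‖v‖ := by
    rw [hp, ← inner_sub_right, ← hv, real_inner_self_eq_norm_mul_norm]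
  have hder : ∀ᵐ t ∂(volume.restrict (Icc a b)), deriv p t ≤ ‖v‖ * ω L * φ t := by
    filter_upwards [hD, ae_restrict_mem measurableSet_Icc] with t ⟨hd₁, hd₂, hest⟩ ht
    have hpd : HasDerivAt p (inner ℝ v (f t (γ₁ t) - f t (γ₂ t))) t := by
      simpa using (hasDerivAt_const t v).inner ℝ (hd₁.sub hd₂)
    rw [hpd.deriv]
    have hωt : ω ‖γ₁ t - γ₂ t‖ ≤ ω L :=
      hω.monotoneOn (mem_Ici.2 (norm_nonneg _)) hL0 (hL t ht)
    calc inner ℝ v (f t (γ₁ t) - f t (γ₂ t)) ≤ ‖v‖ * ‖f t (γ₁ t) - f t (γ₂ t)‖ :=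
          real_inner_le_norm _ _
      _ ≤ ‖v‖ * (φ t * ω L) := by
          refine mul_le_mul_of_nonneg_left ((hest _ (hB₁ t ht) _ (hB₂ t ht)).trans ?_) hv0.le
          exact mul_le_mul_of_nonneg_left hωt (hφ0 t).le
      _ = ‖v‖ * ω L * φ t := by ring
  have hmain : ‖v‖ * ‖v‖ ≤ ‖v‖ * ω L * ∫ t in a..b, φ t := by
    rw [← hpv, ← hpac.integral_deriv_eq_sub, ← intervalIntegral.integral_const_mul]
    exact intervalIntegral.integral_mono_ae_restrict hab hpac.intervalIntegrable_deriv
      (hφ.const_mul _) hder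
  rw [mul_assoc] at hmain
  exact le_of_mul_le_mul_left hmain hv0

/-- Two solutions in `B` that agree at one end of an interval agree at the other end. -/
lemma IsOsgoodModulus.eq_iff_of_hasDerivAt {f : ℝ → Eucl n → Eucl n} {B : Set (Eucl n)}
    {φ : ℝ → ℝ} {γ₁ γ₂ : ℝ → Eucl n} (hω : IsOsgoodModulus ω) (hab : a ≤ b)
    (h₁ : AbsolutelyContinuousOnInterval γ₁ a b) (h₂ : AbsolutelyContinuousOnInterval γ₂ a b)
    (hB₁ : ∀ t ∈ Icc a b, γ₁ t ∈ B) (hB₂ : ∀ t ∈ Icc a b, γ₂ t ∈ B)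
    (hφ0 : ∀ t, 0 < φ t) (hφ : IntervalIntegrable φ volume a b)
    (hD : ∀ᵐ t ∂(volume.restrict (Icc a b)), HasDerivAt γ₁ (f t (γ₁ t)) t ∧
      HasDerivAt γ₂ (f t (γ₂ t)) t ∧ ∀ y ∈ B, ∀ z ∈ B, ‖f t y - f t z‖ ≤ φ t * ω ‖y - z‖) :
    γ₁ a = γ₂ a ↔ γ₁ b = γ₂ b := by
  have hsub : ∀ t' ∈ Icc a b, ∀ t ∈ Icc a b, IntervalIntegrable φ volume t' t := fun t' ht' t ht =>
    hφ.mono_set (by rw [uIcc_of_le hab]; exact uIcc_subset_Icc ht' ht)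
  have hac : ContinuousOn (fun t => ‖γ₁ t - γ₂ t‖) (Icc a b) := by
    have := (h₁.continuousOn.sub h₂.continuousOn).norm
    rwa [uIcc_of_le hab] at this
  have ha : a ∈ Icc a b := left_mem_Icc.2 hab
  have hdiff : ∀ t' ∈ Icc a b, ∀ t ∈ Icc a b,
      (∫ τ in a..t, φ τ) - (∫ τ in a..t', φ τ) = ∫ τ in t'..t, φ τ := fun t' ht' t ht =>
    intervalIntegral.integral_interval_sub_left (hsub a ha t ht) (hsub a ha t' ht')
  have key := hω.nonpos_of_abs_sub_le (Φ := fun t => ∫ τ in a..t, φ τ) (a := a) (b := b)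
    (d := fun t => ‖γ₁ t - γ₂ t‖) (fun t' ht' t ht htt => by
      have := intervalIntegral.integral_nonneg (μ := volume) htt fun τ _ => (hφ0 τ).le
      linarith [hdiff t' ht' t ht]) hac hab
    fun t' ht' t ht L hL => by
      have htI : t ∈ Icc a b := ⟨ht'.1.trans ht.1, ht.2⟩
      have hI : Icc t' t ⊆ Icc a b := Icc_subset_Icc ht'.1 ht.2
      have hI' : uIcc t' t ⊆ uIcc a b := by rwa [uIcc_of_le hab, uIcc_of_le ht.1]
      rw [hdiff t' ht' t htI]
      exact abs_norm_sub_le_of_hasDerivAt hω ht.1 (h₁.mono hI') (h₂.mono hI')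
        (fun τ hτ => hB₁ τ (hI hτ)) (fun τ hτ => hB₂ τ (hI hτ)) hφ0 (hsub t' ht' t htI)
        (ae_restrict_of_ae_restrict_of_subset hI hD) hL
  constructor
  · intro h
    exact sub_eq_zero.1 (norm_le_zero_iff.1 (key.1 (by simp [h])))
  · intro h
    exact sub_eq_zero.1 (norm_le_zero_iff.1 (key.2 (by simp [h])))

/-- Curves solving the same equation agree on the whole time interval if the Osgood estimate holds
locally in space and time, up to the initial time: the set of the times around which the curves
agree is open and closed. -/
theorem IsOsgoodModulus.eqOn_of_isSolutionNear {I : Set ℝ} {Ω : Set (Eucl n)}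
    {f : ℝ → Eucl n → Eucl n} {s ε : ℝ} {x : Eucl n} {γ₁ γ₂ : ℝ → Eucl n}
    (hω : IsOsgoodModulus ω) (hI : IsOpen I) (hIc : I.OrdConnected) (hs : s ∈ closure I)
    (hε : 0 < ε) (hx : x ∈ Ω)
    (hloc : ∀ t₀ ∈ insert s (I ∩ Ioo (s - ε) (s + ε)), ∀ y ∈ Ω, ∃ R > 0, ∃ φ : ℝ → ℝ, ∃ ρ > 0,
      (∀ t, 0 < φ t) ∧ IntegrableOn φ (I ∩ Icc (t₀ - ρ) (t₀ + ρ)) ∧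
      ∀ᵐ t ∂(volume.restrict I), ∀ z ∈ Metric.ball y R, ∀ z' ∈ Metric.ball y R,
        ‖f t z - f t z'‖ ≤ φ t * ω ‖z - z'‖)
    (h₁ : IsSolutionNear I Ω f s x ε γ₁) (h₂ : IsSolutionNear I Ω f s x ε γ₂) :
    EqOn γ₁ γ₂ (I ∩ Ioo (s - ε) (s + ε)) := by
  set A := I ∩ Ioo (s - ε) (s + ε) with hA
  set T := insert s A with hT
  have hsO : s ∈ Ioo (s - ε) (s + ε) := ⟨by linarith, by linarith⟩
  have hTO : T ⊆ Ioo (s - ε) (s + ε) := insert_subset hsO inter_subset_right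
  have hAo : IsOpen A := hI.inter isOpen_Ioo
  have hAm : MeasurableSet A := hAo.measurableSet
  have hsA : s ∈ closure A := by
    rw [hA, inter_comm]
    exact isOpen_Ioo.inter_closure ⟨hsO, hs⟩
  have hTpre : IsPreconnected T :=
    (hIc.inter ordConnected_Ioo).isPreconnected.subset_closure (subset_insert s A)
      (insert_subset hsA subset_closure)
  have hTc : T.OrdConnected := hTpre.ordConnected
  have huIcc : uIcc (s - ε) (s + ε) = Icc (s - ε) (s + ε) := uIcc_of_le (by linarith)
  have hcont : ∀ {γ : ℝ → Eucl n}, IsSolutionNear I Ω f s x ε γ → ∀ t ∈ T, ContinuousAt γ t :=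
    fun hγ t ht => hγ.absolutelyContinuous.continuousOn.continuousAt
      (by rw [huIcc]; exact Icc_mem_nhds (hTO ht).1 (hTO ht).2)
  have hmem : ∀ {γ : ℝ → Eucl n}, IsSolutionNear I Ω f s x ε γ → ∀ t ∈ T, γ t ∈ Ω := by
    rintro γ hγ t (rfl | ht)
    · rwa [hγ.initial]
    · exact hγ.mem t ht
  have hlocal : ∀ t₀ ∈ T, γ₁ t₀ = γ₂ t₀ → ∀ᶠ t in 𝓝 t₀, t ∈ T → γ₁ t = γ₂ t := by
    intro t₀ ht₀ heq
    obtain ⟨R, hR, φ, ρ, hρ, hφ0, hφ, hest⟩ := hloc t₀ ht₀ (γ₁ t₀) (hmem h₁ t₀ ht₀)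
    have hb₁ : ∀ᶠ t in 𝓝 t₀, γ₁ t ∈ Metric.ball (γ₁ t₀) R :=
      hcont h₁ t₀ ht₀ (Metric.ball_mem_nhds _ hR)
    have hb₂ : ∀ᶠ t in 𝓝 t₀, γ₂ t ∈ Metric.ball (γ₁ t₀) R := by
      rw [heq]
      exact hcont h₂ t₀ ht₀ (Metric.ball_mem_nhds _ hR)
    have hbρ : ∀ᶠ t in 𝓝 t₀, t ∈ Icc (t₀ - ρ) (t₀ + ρ) :=
      Icc_mem_nhds (by linarith) (by linarith)
    obtain ⟨η, hη, hball⟩ := Metric.eventually_nhds_iff_ball.1 (hb₁.and (hb₂.and hbρ))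
    filter_upwards [Metric.ball_mem_nhds t₀ hη] with t ht htT
    have hconv : (Metric.ball t₀ η).OrdConnected := (convex_ball t₀ η).ordConnected
    have ht₀b := Metric.mem_ball_self (x := t₀) hη
    -- to be applied with `t₀` as the left or as the right end point
    have key : ∀ a b, a ≤ b → a ∈ T → b ∈ T → a ∈ Metric.ball t₀ η → b ∈ Metric.ball t₀ η →
        (γ₁ a = γ₂ a ↔ γ₁ b = γ₂ b) := by
      intro a b hab haT hbT ha hb
      have hsubT : Icc a b ⊆ T := hTc.out haT hbT
      have hsubB : Icc a b ⊆ Metric.ball t₀ η := hconv.out ha hb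
      have hsub : uIcc a b ⊆ uIcc (s - ε) (s + ε) := by
        rw [huIcc, uIcc_of_le hab]
        exact hsubT.trans (hTO.trans Ioo_subset_Icc_self)
      have hae : ∀ᵐ t ∂(volume.restrict (Icc a b)), t ∈ A := by
        filter_upwards [ae_restrict_mem measurableSet_Icc,
          ae_restrict_of_ae (Measure.ae_ne volume s)] with t ht hts
        exact (hsubT ht).resolve_left hts
      have hle : volume.restrict (Icc a b) ≤ volume.restrict A := by
        rw [← Measure.restrict_eq_self_of_ae_mem hae, Measure.restrict_restrict hAm]
        exact Measure.restrict_mono inter_subset_left le_rfl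
      have hφI : IntegrableOn φ (Icc a b) := by
        have h1 : IntegrableOn φ (Icc a b ∩ A) := hφ.mono_set fun t ht =>
          ⟨ht.2.1, (hball t (hsubB ht.1)).2.2⟩
        rw [IntegrableOn, ← Measure.restrict_eq_self_of_ae_mem hae,
          Measure.restrict_restrict hAm, inter_comm]
        exact h1
      refine hω.eq_iff_of_hasDerivAt (f := f) hab (h₁.absolutelyContinuous.mono hsub)
        (h₂.absolutelyContinuous.mono hsub) (fun t ht => (hball t (hsubB ht)).1)
        (fun t ht => (hball t (hsubB ht)).2.1) hφ0
        ((intervalIntegrable_iff_integrableOn_Icc_of_le hab).2 hφI) ?_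
      filter_upwards [ae_mono hle h₁.hasDerivAt, ae_mono hle h₂.hasDerivAt,
        ae_mono (hle.trans (Measure.restrict_mono inter_subset_left le_rfl)) hest]
        with t hd₁ hd₂ he
      exact ⟨hd₁, hd₂, he⟩
    rcases le_total t₀ t with hle | hle
    · exact (key t₀ t hle ht₀ htT ht₀b ht).1 heq
    · exact (key t t₀ hle htT ht₀ ht ht₀b).2 heq
  set U : Set ℝ := {t | ∀ᶠ t' in 𝓝 t, t' ∈ T → γ₁ t' = γ₂ t'} with hU
  have hUo : IsOpen U := isOpen_setOfPred_eventually_nhds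
  have hsT : s ∈ T := mem_insert s A
  have hs12 : γ₁ s = γ₂ s := h₁.initial.trans h₂.initial.symm
  have hTU : T ⊆ U := by
    refine hTpre.subset_of_closure_inter_subset hUo ⟨s, hsT, hlocal s hsT hs12⟩ ?_
    rintro t ⟨htU, htT⟩
    refine hlocal t htT ?_
    rcases htT with rfl | htA
    · exact hs12
    · have htT : t ∈ T := Or.inr htA
      have hfreq : ∃ᶠ t' in 𝓝 t, γ₁ t' = γ₂ t' :=
        ((mem_closure_iff_frequently.1 htU).and_eventually (hAo.mem_nhds htA)).mono
          fun t' ht' => ht'.1.self_of_nhds (Or.inr ht'.2)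
      by_contra hne
      exact hfreq (((hcont h₁ t htT).sub (hcont h₂ t htT)).eventually_ne (sub_ne_zero.2 hne)|>.mono
        fun t' ht' h' => ht' (sub_eq_zero.2 h'))
  exact fun t ht => (hTU (Or.inr ht)).self_of_nhds (Or.inr ht)

end Osgood

/-! ### Well-posedness -/

section WellPosed

variable {n : ℕ} {Θ ω : ℝ → ℝ} {I : Set ℝ} {Ω : Set (Eucl n)} {b b' : ℝ → Eucl n → Eucl n}
  {D : ℝ → Eucl n → Eucl n →L[ℝ] Eucl n} {s ρ : ℝ} {x : Eucl n}

/-- Solutions exist on short intervals around any time near which `b'` is dominated, close to the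
initial point, by an integrable function of time. -/
lemma MemL1locW11loc.exists_isSolutionNear (hb : MemL1locW11loc I Ω b D) (hI : IsOpen I)
    (hΩ : IsOpen Ω) (hb' : IsContinuousRepresentative I Ω b b') (hρ : 0 < ρ) {r : ℝ} (hr : 0 < r)
    (hrΩ : Metric.ball x r ⊆ Ω) {m : ℝ → ℝ} (hm : IntegrableOn m (I ∩ Ioo (s - ρ) (s + ρ)))
    (hbm : ∀ᵐ t ∂(volume.restrict I), ∀ y ∈ Metric.ball x r, ‖b' t y‖ ≤ m t) :
    ∃ ε > 0, ε ≤ ρ ∧ ∃ γ, IsSolutionNear I Ω b' s x ε γ := by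
  have hsmall : Tendsto (fun ε => ∫ t in Ioo (s - ε) (s + ε), m t
      ∂(volume.restrict (I ∩ Ioo (s - ρ) (s + ρ)))) (𝓝[>] 0) (𝓝 0) := by
    refine Integrable.tendsto_setIntegral_nhds_zero hm ?_
    have hvol : Tendsto (fun ε : ℝ => ENNReal.ofReal ((s + ε) - (s - ε))) (𝓝[>] 0) (𝓝 0) := by
      have hc : Continuous fun ε : ℝ => ENNReal.ofReal ((s + ε) - (s - ε)) :=
        ENNReal.continuous_ofReal.comp (by fun_prop)
      simpa using (hc.tendsto 0).mono_left nhdsWithin_le_nhds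
    refine tendsto_of_tendsto_of_tendsto_of_le_of_le tendsto_const_nhds hvol
      (fun _ => zero_le) fun ε => ?_
    exact (Measure.restrict_apply_le _ _).trans_eq Real.volume_Ioo
  obtain ⟨ε, hεr, hε0, hερ⟩ := ((hsmall.eventually_le_const (half_pos hr)).and
    (Ioc_mem_nhdsGT hρ)).exists
  have hsub : Ioo (s - ε) (s + ε) ⊆ Ioo (s - ρ) (s + ρ) :=
    Ioo_subset_Ioo (by linarith) (by linarith)
  have hX : Metric.closedBall x (r / 2) ⊆ Metric.ball x r :=
    Metric.closedBall_subset_ball (by linarith)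
  have hr2 : 0 ≤ r / 2 := by linarith
  have hle : volume.restrict (I ∩ Ioo (s - ε) (s + ε)) ≤ volume.restrict I :=
    Measure.restrict_mono inter_subset_left le_rfl
  have hC : IsCaratheodoryOn (I ∩ Ioo (s - ε) (s + ε)) (Metric.closedBall x (r / 2)) b' m :=
    { measurableSet := hI.measurableSet.inter measurableSet_Ioo
      aestronglyMeasurable := fun y hy =>
        (hb.aestronglyMeasurable_apply hΩ hb' (hrΩ (hX hy))).mono_measure hle
      continuousOn := Eventually.mono (ae_mono hle hb') fun t ht => ht.1.mono (hX.trans hrΩ)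
      integrableOn := hm.mono_set (inter_subset_inter_right I hsub)
      norm_le := Eventually.mono (ae_mono hle hbm) fun t ht y hy => ht y (hX hy) }
  refine ⟨ε, hε0, hερ, hC.exists_isSolutionNear (isCompact_closedBall x _) (hX.trans hrΩ)
    (Metric.closedBall_subset_closedBall ?_) (Metric.mem_closedBall_self hr2) hε0⟩
  rw [Measure.restrict_restrict measurableSet_Ioo, inter_left_comm,
    inter_eq_left.2 hsub] at hεr
  exact hεr

/-- Uniqueness of solutions for initial times in `J`, which is the time interval or its closure. -/
lemma MemL1locW11loc.eqOn_of_isSolutionNear (hb : MemL1locW11loc I Ω b D)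
    (hΘ : IsAdmissibleTheta n Θ) (hω : IsOrliczModulus n Θ ω) (hωo : IsOsgoodModulus ω)
    (hI : IsOpen I) (hIc : I.OrdConnected) {J : Set ℝ} (hIJ : I ⊆ J) (hJI : J ⊆ closure I)
    (hJ : volume.restrict J = volume.restrict I)
    (hJc : ∀ t ∈ J, ∃ ρ > 0, IsCompact (J ∩ Icc (t - ρ) (t + ρ)))
    (hO : LocallyOrliczIntegrable Θ J Ω D) (hb' : IsContinuousRepresentative I Ω b b')
    (hs : s ∈ J) (hx : x ∈ Ω) {ε : ℝ} (hε : 0 < ε) {γ₁ γ₂ : ℝ → Eucl n}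
    (h₁ : IsSolutionNear I Ω b' s x ε γ₁) (h₂ : IsSolutionNear I Ω b' s x ε γ₂) :
    EqOn γ₁ γ₂ (I ∩ Ioo (s - ε) (s + ε)) := by
  refine hωo.eqOn_of_isSolutionNear hI hIc (hJI hs) hε hx (fun t₀ ht₀ y hy => ?_) h₁ h₂
  obtain ⟨ρ, hρ, hρc⟩ :=
    hJc t₀ (insert_subset hs (inter_subset_left.trans hIJ) ht₀)
  obtain ⟨c, hc, R, hR, hRΩ, hcR⟩ := hO y hy
  obtain ⟨φ, hφ0, hφi, -, hφ⟩ := hb.exists_osgood_estimate hΘ hω hI hIJ hJ hc hR hRΩ hcR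
  refine ⟨R, hR, φ, ρ, hρ, hφ0,
    (hφi _ hρc inter_subset_left).mono_set (inter_subset_inter_left _ hIJ), ?_⟩
  filter_upwards [hφ, hb'] with t h1 h2
  exact h1 _ h2.1 h2.2

lemma exists_Icc_subset_of_isOpen (hI : IsOpen I) (hs : s ∈ I) :
    ∃ ρ > 0, Icc (s - ρ) (s + ρ) ⊆ I := by
  obtain ⟨ρ, hρ, h⟩ := Metric.nhds_basis_closedBall.mem_iff.1 (hI.mem_nhds hs)
  exact ⟨ρ, hρ, by rwa [← Real.closedBall_eq_Icc]⟩

theorem MemL1locW11loc.wellPosed (hb : MemL1locW11loc I Ω b D) (hΘ : IsAdmissibleTheta n Θ)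
    (hω : IsOrliczModulus n Θ ω) (hωo : IsOsgoodModulus ω) (hI : IsOpen I)
    (hIc : I.OrdConnected) (hΩ : IsOpen Ω) (hO : LocallyOrliczIntegrable Θ I Ω D)
    (hb' : IsContinuousRepresentative I Ω b b') : WellPosed I Ω b' := by
  intro s hs x hx
  obtain ⟨ρ, hρ, hρI⟩ := exists_Icc_subset_of_isOpen hI hs
  obtain ⟨c, hc, R, hR, hRΩ, hcR⟩ := hO x hx
  obtain ⟨φ, hφ0, hφi, -, hφ⟩ := hb.exists_osgood_estimate hΘ hω hI le_rfl rfl hc hR hRΩ hcR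
  have hRΩ' : Metric.ball x R ⊆ Ω := (Metric.ball_subset_ball (by linarith)).trans hRΩ
  obtain ⟨m, hmi, hm⟩ := hb.exists_norm_le hωo hb' hR hRΩ' hφ0 hφi (by
    filter_upwards [hφ, hb'] with t h1 h2
    exact h1 _ h2.1 h2.2)
  obtain ⟨ε, hε, hερ, hγ⟩ := hb.exists_isSolutionNear (s := s) hI hΩ hb' hρ hR hRΩ'
    ((hmi _ isCompact_Icc hρI).mono_set (inter_subset_right.trans Ioo_subset_Icc_self)) hm
  refine ⟨ε, hε, (Ioo_subset_Icc_self.trans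
    (Icc_subset_Icc (by linarith) (by linarith))).trans hρI, hγ, fun γ₁ γ₂ h₁ h₂ => ?_⟩
  refine hb.eqOn_of_isSolutionNear hΘ hω hωo hI hIc le_rfl subset_closure rfl (fun t ht => ?_) hO
    hb' hs hx hε h₁ h₂
  obtain ⟨ρ, hρ, hρI⟩ := exists_Icc_subset_of_isOpen hI ht
  exact ⟨ρ, hρ, by rw [inter_eq_right.2 hρI]; exact isCompact_Icc⟩

/-- A bound on `b` that holds almost everywhere in space holds everywhere for the continuous
representative. -/
lemma IsContinuousRepresentative.norm_le (hb' : IsContinuousRepresentative I Ω b b')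
    {B : Set (Eucl n)} (hB : IsOpen B) (hBΩ : B ⊆ Ω) {m : ℝ → ℝ}
    (hm : ∀ᵐ t ∂(volume.restrict I), ∀ᵐ y ∂(volume.restrict B), ‖b t y‖ ≤ m t) :
    ∀ᵐ t ∂(volume.restrict I), ∀ y ∈ B, ‖b' t y‖ ≤ m t := by
  filter_upwards [hb', hm] with t ⟨hc, he⟩ hmt
  have hcB : ContinuousOn (b' t) B := hc.mono hBΩ
  have hae : (fun y => max ‖b' t y‖ (m t)) =ᵐ[volume.restrict B] fun _ => m t := by
    filter_upwards [ae_restrict_of_ae_restrict_of_subset hBΩ he, hmt] with y h1 h2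
    rw [h1]
    exact max_eq_right h2
  have := Measure.eqOn_open_of_ae_eq hae hB (hcB.norm.sup continuousOn_const) continuousOn_const
  exact fun y hy => max_eq_right_iff.1 (this hy)

/-- Solutions with initial times at the end points of the time interval. -/
theorem MemL1locW11loc.exists_isSolutionNear_closure (hb : MemL1locW11loc I Ω b D) (hI : IsOpen I)
    (hΩ : IsOpen Ω) (hb' : IsContinuousRepresentative I Ω b b')
    (hm : ∀ o ∈ Ω, ∃ r > 0, ∃ m : ℝ → ℝ, IntegrableOn m I ∧ ∀ᵐ t ∂(volume.restrict I),
      ∀ᵐ x ∂(volume.restrict (Metric.ball o r ∩ Ω)), ‖b t x‖ ≤ m t) (hx : x ∈ Ω) (s : ℝ) :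
    ∃ ε > 0, ∃ γ, IsSolutionNear I Ω b' s x ε γ := by
  obtain ⟨r, hr, m, hmi, hbm⟩ := hm x hx
  obtain ⟨r', hr', hrB⟩ := Metric.isOpen_iff.1 (Metric.isOpen_ball.inter hΩ) x
    ⟨Metric.mem_ball_self hr, hx⟩
  have hB := hb'.norm_le (Metric.isOpen_ball.inter hΩ) inter_subset_right hbm
  obtain ⟨ε, hε, -, hγ⟩ := hb.exists_isSolutionNear (s := s) hI hΩ hb' one_pos hr'
    (hrB.trans inter_subset_right) (hmi.mono_set inter_subset_left)
    (hB.mono fun t ht y hy => ht y (hrB hy))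
  exact ⟨ε, hε, hγ⟩

lemma restrict_closure_eq_of_ordConnected (hI : I.OrdConnected) :
    volume.restrict (closure I) = volume.restrict I :=
  Measure.restrict_congr_set
    (closure_ae_eq_of_null_frontier (hI.convex.addHaar_frontier volume))

end WellPosed

theorem mainTheorem1 (n : ℕ) (hn : 1 ≤ n) (Θ : ℝ → ℝ) (hΘ : IsAdmissibleTheta n Θ) :
    ∃ ω : ℝ → ℝ, IsOsgoodModulus ω ∧
      ∀ (I : Set ℝ) (Ω : Set (Eucl n)) (b : ℝ → Eucl n → Eucl n)
        (D : ℝ → Eucl n → Eucl n →L[ℝ] Eucl n),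
        IsOpen I → I.OrdConnected → IsOpen Ω →
        MemL1locW11loc I Ω b D →
        LocallyOrliczIntegrable Θ I Ω D →
        -- existence of a representative that is continuous in space
        (∃ b' : ℝ → Eucl n → Eucl n, IsContinuousRepresentative I Ω b b') ∧
        ∀ b' : ℝ → Eucl n → Eucl n, IsContinuousRepresentative I Ω b b' →
          -- the Osgood estimate
          (∀ (o : Eucl n) (c R : ℝ), 0 < c → 0 < R → Metric.ball o (2 * R) ⊆ Ω →
            OrliczIntegrable Θ I D o c R →
            ∃ φ : ℝ → ℝ, (∀ t, 0 < φ t) ∧ LocallyIntegrableOn φ I ∧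
              ∀ᵐ t ∂(volume.restrict I), ∀ x ∈ Metric.ball o R, ∀ y ∈ Metric.ball o R,
                ‖b' t x - b' t y‖ ≤ φ t * ω ‖x - y‖) ∧
          -- well-posedness in the open interval
          WellPosed I Ω b' ∧
          -- behaviour up to the endpoints of the interval
          ((∀ o ∈ Ω, ∃ r > 0, ∃ m : ℝ → ℝ, IntegrableOn m I ∧
              ∀ᵐ t ∂(volume.restrict I),
                ∀ᵐ x ∂(volume.restrict (Metric.ball o r ∩ Ω)), ‖b t x‖ ≤ m t) →
            (∀ s ∈ closure I, ∀ x ∈ Ω, ∃ ε > 0, ∃ γ, IsSolutionNear I Ω b' s x ε γ) ∧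
            (LocallyOrliczIntegrable Θ (closure I) Ω D → WellPosedClosure I Ω b')) := by
  obtain ⟨ω, hωo, hω⟩ := hΘ.exists_isOrliczModulus hn
  refine ⟨ω, hωo, fun I Ω b D hI hIc hΩ hb hO => ⟨hb.exists_isContinuousRepresentative hΘ hω hωo hI
    hΩ hO, fun b' hb' => ⟨fun o c R hc hR hRΩ hcR => ?_, hb.wellPosed hΘ hω hωo hI hIc hΩ hO hb',
    fun hm => ⟨fun s _ x hx => hb.exists_isSolutionNear_closure hI hΩ hb' hm hx s,
      fun hOc s hs x hx => ?_⟩⟩⟩⟩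
  · obtain ⟨φ, hφ0, hφi, -, hφ⟩ := hb.exists_osgood_estimate hΘ hω hI le_rfl rfl hc hR hRΩ hcR
    refine ⟨φ, hφ0, (locallyIntegrableOn_iff hI.isLocallyClosed).2 fun K hKI hK => hφi K hK hKI, ?_⟩
    filter_upwards [hφ, hb'] with t h1 h2
    exact h1 _ h2.1 h2.2
  · obtain ⟨ε, hε, hγ⟩ := hb.exists_isSolutionNear_closure hI hΩ hb' hm hx s
    exact ⟨ε, hε, hγ, fun γ₁ γ₂ h₁ h₂ => hb.eqOn_of_isSolutionNear hΘ hω hωo hI hIc subset_closure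
      le_rfl (restrict_closure_eq_of_ordConnected hIc)
      (fun t _ => ⟨1, one_pos, isCompact_Icc.inter_left isClosed_closure⟩) hOc hb' hs hx hε h₁ h₂⟩
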